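/- Let $(M,F)$ be a reversible Finsler manifold: $M$ is a connected, Hausdorff, second-countable smooth manifold of finite dimension, and $F:TM\to[0,\infty)$ is continuous, smooth off the zero section, with each $F(x,\cdot)$ a Minkowski norm (a positive definite, positively homogeneous, subadditive function with $\tfrac12 d^2(F^2)_v$ positive definite for $v\ne0$) such that $F(x,-v)=F(x,v)$. Let $\mathsf d_F$ be the Finsler distance (the infimum of the lengths $\int_0^1F(\gamma_t,\dot\gamma_t)\,dt$ of piecewise $C^1$ curves), $F^*(x,\cdot)$ the dual norm on $T^*_xM$, and $\mu$ a nonnegative Radon measure on $M$. Let $\Gamma_2(T^*M;\mu)$ be the space of measurable sections $\underline\omega$ of $T^*M$, modulo equality $\mu$-a.e., such that the pointwise norm $|\underline\omega|(x):=F^*(x,\underline\omega(x))$ lies in $L^2(\mu)$, with the norm $\|\,|\underline\omega|\,\|_{L^2(\mu)}$ and the pointwise multiplication by $L^\infty(\mu)$; for $f\in C^1_c(M)$ let $\underline df\in\Gamma_2(T^*M;\mu)$ be its differential. Let $W^{1,2}(M,\mathsf d_F,\mu)$ be the Sobolev space of those $f\in L^2(\mu)$ for which there is a weak upper gradient, that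 is, a $G\in L^2(\mu)$ with $G\ge0$ and $\int|f(\gamma_1)-f(\gamma_0)|\,d\pi(\gamma)\le\int\!\int_0^1G(\gamma_t)|\dot\gamma_t|\,dt\,d\pi(\gamma)$ for every test plan $\pi$ (a Borel probability measure on $C([0,1],M)$ with $(e_t)_*\pi\le C\mu$ for all $t$ and some constant $C$, where $e_t(\gamma)=\gamma_t$, concentrated on $\mathsf d_F$-absolutely continuous curves with $\int\!\int_0^1|\dot\gamma_t|^2\,dt\,d\pi<\infty$, where $|\dot\gamma_t|$ is the metric speed). Let $|Df|$ be the minimal weak upper gradient of $f$. Let $L^2_\mu(T^*M)$ be the cotangent module, the $L^2(\mu)$-normed $L^\infty(\mu)$-module obtained by completing the space of simple forms $\sum_i\chi_{E_i}df_i$ ($(E_i)$ a finite Borel partition of $M$, $f_i\in W^{1,2}(M,\mathsf d_F,\mu)$) with respect to the norm $\|\sum_i\chi_{E_i}|Df_i|\|_{L^2(\mu)}$, and let $d:W^{1,2}(M,\mathsf d_F,\mu)\to L^2_\mu(T^*M)$ be its differential; thus $|df|=|Df|$ $\mu$-a.e., and the elements $df$ generate $L^2_\mu(T^*M)$ as a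 module. Then $C^1_c(M)\subseteq W^{1,2}(M,\mathsf d_F,\mu)$, and there exists a unique $L^\infty(\mu)$-linear and continuous operator $$P:\Gamma_2(T^*M;\mu)\longrightarrow L^2_\mu(T^*M)$$ such that $P(\underline df)=df$ for every $f\in C^1_c(M)$. Moreover, $|P(\underline\omega)|\le|\underline\omega|$ holds $\mu$-a.e. for every $\underline\omega\in\Gamma_2(T^*M;\mu)$. -/

import Mathlib

open MeasureTheory Filter Topology Set
open scoped ENNReal NNReal Manifold

noncomputable section

namespace FinslerModules

section Linfty

variable {X : Type*} [MeasurableSpace X] {μ : Measure X}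

instance instCommRingAEEqFun : CommRing (X →ₘ[μ] ℝ) :=
  { (inferInstance : AddCommGroup (X →ₘ[μ] ℝ)), (inferInstance : CommMonoid (X →ₘ[μ] ℝ)) with
    left_distrib := fun a b c => by
      refine AEEqFun.ext ?_
      filter_upwards [AEEqFun.coeFn_mul a (b + c), AEEqFun.coeFn_add b c,
        AEEqFun.coeFn_add (a * b) (a * c), AEEqFun.coeFn_mul a b, AEEqFun.coeFn_mul a c]
        with x h1 h2 h3 h4 h5
      simp only [h1, h2, h3, h4, h5, Pi.mul_apply, Pi.add_apply, mul_add]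
    right_distrib := fun a b c => by
      refine AEEqFun.ext ?_
      filter_upwards [AEEqFun.coeFn_mul (a + b) c, AEEqFun.coeFn_add a b,
        AEEqFun.coeFn_add (a * c) (b * c), AEEqFun.coeFn_mul a c, AEEqFun.coeFn_mul b c]
        with x h1 h2 h3 h4 h5
      simp only [h1, h2, h3, h4, h5, Pi.mul_apply, Pi.add_apply, add_mul]
    zero_mul := fun a => by
      refine AEEqFun.ext ?_
      filter_upwards [AEEqFun.coeFn_mul 0 a, AEEqFun.coeFn_zero (β := ℝ) (μ := μ)] with x h1 h2
      simp only [h1, h2, Pi.mul_apply, Pi.zero_apply, zero_mul]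
    mul_zero := fun a => by
      refine AEEqFun.ext ?_
      filter_upwards [AEEqFun.coeFn_mul a 0, AEEqFun.coeFn_zero (β := ℝ) (μ := μ)] with x h1 h2
      simp only [h1, h2, Pi.mul_apply, Pi.zero_apply, mul_zero] }

instance instAlgebraAEEqFun : Algebra ℝ (X →ₘ[μ] ℝ) :=
  Algebra.ofModule
    (fun r a b => by
      refine AEEqFun.ext ?_
      filter_upwards [AEEqFun.coeFn_mul (r • a) b, AEEqFun.coeFn_smul r a,
        AEEqFun.coeFn_smul r (a * b), AEEqFun.coeFn_mul a b] with x h1 h2 h3 h4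
      simp only [h1, h2, h3, h4, Pi.mul_apply, Pi.smul_apply, smul_eq_mul, mul_assoc])
    (fun r a b => by
      refine AEEqFun.ext ?_
      filter_upwards [AEEqFun.coeFn_mul a (r • b), AEEqFun.coeFn_smul r b,
        AEEqFun.coeFn_smul r (a * b), AEEqFun.coeFn_mul a b] with x h1 h2 h3 h4
      simp only [h1, h2, h3, h4, Pi.mul_apply, Pi.smul_apply, smul_eq_mul, mul_left_comm])

variable (μ) in
/-- The algebra `L^∞(μ)` of (a.e. classes of) essentially bounded real functions. -/
def Linfty : Subalgebra ℝ (X →ₘ[μ] ℝ) where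
  carrier := {f | eLpNorm f ⊤ μ < ⊤}
  mul_mem' := fun {a b} ha hb => by
    have h1 : MemLp a ⊤ μ := ⟨a.aestronglyMeasurable, ha⟩
    have h2 : MemLp b ⊤ μ := ⟨b.aestronglyMeasurable, hb⟩
    have h3 : MemLp ((a : X → ℝ) * (b : X → ℝ)) ⊤ μ := h2.mul h1
    rw [mem_ofPred_eq, eLpNorm_congr_ae (AEEqFun.coeFn_mul a b)]
    exact h3.2
  add_mem' := fun {a b} ha hb => by
    have h1 : MemLp a ⊤ μ := ⟨a.aestronglyMeasurable, ha⟩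
    have h2 : MemLp b ⊤ μ := ⟨b.aestronglyMeasurable, hb⟩
    rw [mem_ofPred_eq, eLpNorm_congr_ae (AEEqFun.coeFn_add a b)]
    exact (h1.add h2).2
  algebraMap_mem' := fun r => by
    have h : (algebraMap ℝ (X →ₘ[μ] ℝ) r : X → ℝ) =ᵐ[μ] fun _ => r := by
      rw [Algebra.algebraMap_eq_smul_one]
      filter_upwards [AEEqFun.coeFn_smul r (1 : X →ₘ[μ] ℝ),
        AEEqFun.coeFn_one (β := ℝ) (μ := μ)] with x h1 h2
      simp [h1, h2]
    rw [mem_ofPred_eq, eLpNorm_congr_ae h]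
    exact (memLp_top_const r).2

theorem Linfty.memLp (a : Linfty μ) : MemLp (a : X →ₘ[μ] ℝ) ⊤ μ :=
  ⟨(a : X →ₘ[μ] ℝ).aestronglyMeasurable, (show (a : X →ₘ[μ] ℝ) ∈ {f : X →ₘ[μ] ℝ | eLpNorm f ⊤ μ < ⊤} from a.2)⟩

/-- The data turning an `L^∞(μ)`-module with a norm into an `L^2(μ)`-normed module: a pointwise
norm `|·|` with values in the nonnegative elements of `L^2(μ)`, such that `‖ |v| ‖ = ‖v‖` and
`|f v| = |f| |v|` hold `μ`-a.e. -/
class L2NormedModule (μ : Measure X) (T : Type*) [NormedAddCommGroup T]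
    [Module (Linfty μ) T] where
  pnorm : T → Lp ℝ 2 μ
  pnorm_nonneg : ∀ v, 0 ≤ pnorm v
  norm_pnorm : ∀ v, ‖pnorm v‖ = ‖v‖
  pnorm_smul : ∀ (a : Linfty μ) (v : T),
    (pnorm (a • v) : X → ℝ) =ᵐ[μ] fun x => |(a : X →ₘ[μ] ℝ) x| * pnorm v x

theorem exists_bound (s : SimpleFunc X ℝ) : ∃ K : ℝ, 0 ≤ K ∧ ∀ x, |s x| ≤ K := by
  obtain ⟨K, hK⟩ := s.exists_forall_norm_le
  exact ⟨|K|, abs_nonneg K, fun x => (hK x).trans (le_abs_self K)⟩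

/-- Multiplication by `|b|` in `L²(μ)`, for bounded `b`. -/
theorem exists_mulAbs {b : X → ℝ} (hb : MemLp b ⊤ μ) :
    ∃ M : Lp ℝ 2 μ →L[ℝ] Lp ℝ 2 μ, ∀ g, M g =ᵐ[μ] fun x => |b x| * g x := by
  have hb' : MemLp (fun x => |b x|) ⊤ μ := hb.abs
  refine ⟨(ContinuousLinearMap.mul ℝ ℝ).holderL μ ⊤ 2 2 hb'.toLp, fun g => ?_⟩
  have h : (ContinuousLinearMap.mul ℝ ℝ).holderL μ ⊤ 2 2 hb'.toLp g =ᵐ[μ] _ :=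
    (ContinuousLinearMap.mul ℝ ℝ).coeFn_holder hb'.toLp g
  filter_upwards [h, hb'.coeFn_toLp] with x h1 h2
  rw [h1, h2]; rfl

theorem exists_ae_bound (a : Linfty μ) :
    ∃ K : ℝ, 0 ≤ K ∧ ∀ᵐ x ∂μ, |(a : X →ₘ[μ] ℝ) x| ≤ K := by
  have h := (Linfty.memLp a).2
  rw [eLpNorm_exponent_top] at h
  refine ⟨(eLpNormEssSup (a : X →ₘ[μ] ℝ) μ).toReal, ENNReal.toReal_nonneg, ?_⟩
  filter_upwards [ae_le_eLpNormEssSup (f := ((a : X →ₘ[μ] ℝ) : X → ℝ)) (μ := μ)] with x hx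
  have := ENNReal.toReal_mono h.ne hx
  simpa using this

end Linfty

section PointwiseSeminorm

variable {X : Type*} [MeasurableSpace X] {μ : Measure X} {V : Type*} [AddCommGroup V] [Module ℝ V]

/-- A seminorm with values in the ordered vector space `L^2(μ)`. -/
structure IsPointwiseSeminorm (p : V → Lp ℝ 2 μ) : Prop where
  nonneg : ∀ v, 0 ≤ p v
  add_le : ∀ v w, p (v + w) ≤ p v + p w
  smul : ∀ (c : ℝ) v, p (c • v) = |c| • p v

theorem IsPointwiseSeminorm.core [Norm V] {p : V → Lp ℝ 2 μ} (hp : IsPointwiseSeminorm p)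
    (hn : ∀ v : V, ‖v‖ = ‖p v‖) : SeminormedSpace.Core ℝ V where
  norm_nonneg v := by rw [hn]; exact norm_nonneg _
  norm_smul c v := by rw [hn, hn, hp.smul, norm_smul, Real.norm_eq_abs, Real.norm_eq_abs, abs_abs]
  norm_triangle v w := by
    rw [hn, hn, hn]
    refine le_trans ?_ (norm_add_le _ _)
    refine norm_le_norm_of_abs_le_abs ?_
    rw [abs_of_nonneg (hp.nonneg _), abs_of_nonneg (add_nonneg (hp.nonneg _) (hp.nonneg _))]
    exact hp.add_le v w

theorem IsPointwiseSeminorm.norm_sub_le {p : V → Lp ℝ 2 μ} (hp : IsPointwiseSeminorm p)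
    (v w : V) : ‖p v - p w‖ ≤ ‖p (v - w)‖ := by
  refine norm_le_norm_of_abs_le_abs ?_
  rw [abs_of_nonneg (hp.nonneg (v - w)), abs_le']
  have h1 := hp.add_le (v - w) w
  have h2 := hp.add_le (w - v) v
  have h3 : p (w - v) = p (v - w) := by
    have := hp.smul (-1) (v - w)
    simpa using this
  rw [sub_add_cancel] at h1 h2
  rw [h3] at h2
  constructor
  · rwa [sub_le_iff_le_add]
  · rw [neg_sub, sub_le_iff_le_add]; exact h2

/-- A nonempty set of nonnegative elements of `L²(μ)` has an (essential) infimum. -/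
theorem exists_isGLB_Lp (S : Set (Lp ℝ 2 μ)) (hne : S.Nonempty)
    (h0 : ∀ G ∈ S, 0 ≤ G) : ∃ G, IsGLB S G := by
  have hlb : (0 : Lp ℝ 2 μ) ∈ lowerBounds S := fun G hG => h0 G hG
  set A := infClosure S with hA
  have hSA : S ⊆ A := subset_infClosure
  have hAinf : InfClosed A := infClosed_infClosure
  have hA0 : ∀ a ∈ A, 0 ≤ a := by
    have : (0 : Lp ℝ 2 μ) ∈ lowerBounds A := by rwa [hA, lowerBounds_infClosure]
    exact fun a ha => this ha
  have hmono : ∀ a b : Lp ℝ 2 μ, 0 ≤ a → a ≤ b → ‖b - a‖ ^ 2 ≤ ‖b‖ ^ 2 - ‖a‖ ^ 2 := by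
    intro a b ha hab
    have hin : 0 ≤ inner ℝ a (b - a) := by
      rw [L2.inner_def]
      refine integral_nonneg_of_ae ?_
      filter_upwards [(Lp.coeFn_nonneg a).2 ha,
        (Lp.coeFn_nonneg (b - a)).2 (sub_nonneg.2 hab)] with x h1 h2
      simpa using mul_nonneg h2 h1
    have := norm_add_sq_real a (b - a)
    rw [add_sub_cancel] at this
    linarith
  set R := sInf ((fun a : Lp ℝ 2 μ => ‖a‖ ^ 2) '' A) with hR
  have hbdd : BddBelow ((fun a : Lp ℝ 2 μ => ‖a‖ ^ 2) '' A) :=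
    ⟨0, by rintro _ ⟨a, -, rfl⟩; positivity⟩
  have hRle : ∀ a ∈ A, R ≤ ‖a‖ ^ 2 := fun a ha => csInf_le hbdd ⟨a, ha, rfl⟩
  have hdist : ∀ a ∈ A, ∀ b ∈ A, ‖a - a ⊓ b‖ ^ 2 ≤ ‖a‖ ^ 2 - R := by
    intro a ha b hb
    have hab : a ⊓ b ∈ A := hAinf ha hb
    have := hmono (a ⊓ b) a (hA0 _ hab) inf_le_left
    linarith [hRle _ hab]
  obtain ⟨v, -, hv, hvA⟩ := exists_seq_tendsto_sInf ((hne.mono hSA).image _) hbdd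
  choose a haA hav using hvA
  have hlim : Tendsto (fun n => ‖a n‖ ^ 2 - R) atTop (𝓝 0) := by
    have : Tendsto (fun n => ‖a n‖ ^ 2) atTop (𝓝 R) := by simpa only [hav] using hv
    simpa using this.sub_const R
  have hsq : Tendsto (fun n => √(‖a n‖ ^ 2 - R)) atTop (𝓝 0) := by
    simpa [Function.comp_def] using (Real.continuous_sqrt.tendsto 0).comp hlim
  have hdist' : ∀ n, ∀ b ∈ A, ‖a n - a n ⊓ b‖ ≤ √(‖a n‖ ^ 2 - R) := fun n b hb =>
    Real.le_sqrt_of_sq_le (hdist _ (haA n) b hb)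
  have hcau : CauchySeq a := by
    rw [Metric.cauchySeq_iff]
    intro ε hε
    obtain ⟨N, hN⟩ := (hsq.eventually (gt_mem_nhds (half_pos hε))).exists_forall_of_atTop
    refine ⟨N, fun k hk l hl => ?_⟩
    have h1 := (hdist' k _ (haA l)).trans_lt (hN k hk)
    have h2 := (hdist' l _ (haA k)).trans_lt (hN l hl)
    rw [inf_comm] at h2
    calc dist (a k) (a l) ≤ dist (a k) (a k ⊓ a l) + dist (a l) (a k ⊓ a l) :=
          dist_triangle_right _ _ _
      _ < ε := by rw [dist_eq_norm, dist_eq_norm]; linarith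
  obtain ⟨G, hG⟩ := cauchySeq_tendsto_of_complete hcau
  refine ⟨G, fun b hb => ?_, fun l hl => ?_⟩
  · have h1 : Tendsto (fun n => a n ⊓ b) atTop (𝓝 (G ⊓ b)) :=
      (hG.inf_nhds tendsto_const_nhds)
    have h2 : Tendsto (fun n => a n - a n ⊓ b) atTop (𝓝 0) :=
      squeeze_zero_norm (fun n => hdist' n b (hSA hb)) hsq
    have h3 : Tendsto (fun n => a n - a n ⊓ b) atTop (𝓝 (G - G ⊓ b)) := hG.sub h1
    have h4 := tendsto_nhds_unique h3 h2
    rw [sub_eq_zero] at h4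
    exact inf_eq_left.1 h4.symm
  · have : l ∈ lowerBounds A := by rwa [hA, lowerBounds_infClosure]
    exact ge_of_tendsto' hG fun n => this (haA n)

end PointwiseSeminorm

section Sobolev

variable {X : Type*} [TopologicalSpace X]

/-- The space of continuous curves `[0,1] → X` carries its Borel `σ`-algebra. -/
instance instMeasurableSpaceCurves : MeasurableSpace C(unitInterval, X) := borel _

instance instBorelSpaceCurves : BorelSpace C(unitInterval, X) := ⟨rfl⟩

/-- Absolutely continuous curves with respect to a distance function `d`. -/
def IsACCurve (d : X → X → ℝ) (γ : C(unitInterval, X)) : Prop :=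
  ∃ g : ℝ → ℝ, IntegrableOn g (Icc 0 1) volume ∧
    ∀ s t : unitInterval, s ≤ t → d (γ s) (γ t) ≤ ∫ r in (s : ℝ)..t, g r

/-- The metric speed of a curve: `lim_{s → t} d(γ_s, γ_t) / |s - t|`. For absolutely continuous
curves the limit exists for a.e. `t`, so that writing an upper limit is harmless. -/
def metricSpeed (d : X → X → ℝ) (γ : C(unitInterval, X)) (t : unitInterval) : ℝ≥0∞ :=
  limsup (fun s : unitInterval => ENNReal.ofReal (d (γ s) (γ t) / |(s : ℝ) - t|)) (𝓝[≠] t)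

variable [MeasurableSpace X]

/-- Test plans: Borel probability measures on `C([0,1], X)` with bounded compression and finite
kinetic energy `∫ ∫₀¹ |γ'_t|² dt dπ(γ)`, where the inner integral counts as `+∞` if `γ` is not
absolutely continuous; so `π`-a.e. curve has to be absolutely continuous. -/
structure IsTestPlan (d : X → X → ℝ) (m : Measure X) (π : Measure C(unitInterval, X)) : Prop where
  isProbabilityMeasure : IsProbabilityMeasure π
  compression : ∃ C : ℝ≥0, ∀ t : unitInterval, π.map (fun γ => γ t) ≤ C • m
  ae_isACCurve : ∀ᵐ γ ∂π, IsACCurve d γ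
  energy : ∫⁻ γ, (∫⁻ t, metricSpeed d γ t ^ 2) ∂π < ⊤

/-- `G` is a weak upper gradient of `f`. Elements of `L²(m)` are a.e. classes; since test plans
have bounded compression, neither side of the inequality depends on the chosen representatives,
and the inequality is required for one nonnegative Borel representative `g` of `G`. -/
def IsWeakUpperGradient (d : X → X → ℝ) {m : Measure X} (f G : Lp ℝ 2 m) : Prop :=
  0 ≤ G ∧ ∃ g : X → ℝ≥0∞, Measurable g ∧ (g =ᵐ[m] fun x => ENNReal.ofReal (G x)) ∧
    ∀ π : Measure C(unitInterval, X), IsTestPlan d m π →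
      ∫⁻ γ, ‖f (γ 1) - f (γ 0)‖ₑ ∂π ≤ ∫⁻ γ, (∫⁻ t, g (γ t) * metricSpeed d γ t) ∂π

variable [BorelSpace X]

theorem IsTestPlan.ae_comp {d : X → X → ℝ} {m : Measure X} {π : Measure C(unitInterval, X)}
    (hπ : IsTestPlan d m π) {P : X → Prop} (hP : ∀ᵐ x ∂m, P x) (t : unitInterval) :
    ∀ᵐ γ ∂π, P (γ t) := by
  obtain ⟨C, hC⟩ := hπ.compression
  have hm : Measurable (fun γ : C(unitInterval, X) => γ t) :=
    (continuous_eval_const t).measurable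
  have h1 : π.map (fun γ => γ t) ≪ m :=
    (Measure.absolutelyContinuous_of_le (hC t)).trans
      (Measure.smul_absolutelyContinuous)
  exact ae_of_ae_map hm.aemeasurable (h1.ae_le hP)

theorem measurable_increment {m : Measure X} (f : Lp ℝ 2 m) :
    Measurable (fun γ : C(unitInterval, X) => ‖f (γ 1) - f (γ 0)‖ₑ) := by
  have hm : ∀ t : unitInterval, Measurable (fun γ : C(unitInterval, X) => f (γ t)) := fun t =>
    (Lp.stronglyMeasurable f).measurable.comp (continuous_eval_const t).measurable
  exact ((hm 1).sub (hm 0)).enorm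

theorem IsWeakUpperGradient.zero (d : X → X → ℝ) (m : Measure X) :
    IsWeakUpperGradient d (0 : Lp ℝ 2 m) 0 := by
  refine ⟨le_rfl, 0, measurable_zero, ?_, fun π hπ => ?_⟩
  · filter_upwards [Lp.coeFn_zero ℝ 2 m] with x hx
    rw [hx]; simp
  · have h0 := Lp.coeFn_zero ℝ 2 m
    have : ∫⁻ γ : C(unitInterval, X), ‖(0 : Lp ℝ 2 m) (γ 1) - (0 : Lp ℝ 2 m) (γ 0)‖ₑ ∂π = 0 := by
      rw [lintegral_eq_zero_iff (measurable_increment _)]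
      filter_upwards [hπ.ae_comp h0 1, hπ.ae_comp h0 0] with γ h1 h2
      rw [h1, h2]; simp
    rw [this]; exact zero_le

theorem IsWeakUpperGradient.add {d : X → X → ℝ} {m : Measure X} {f f' G G' : Lp ℝ 2 m}
    (h : IsWeakUpperGradient d f G) (h' : IsWeakUpperGradient d f' G') :
    IsWeakUpperGradient d (f + f') (G + G') := by
  obtain ⟨h0, g, hgm, hg, hi⟩ := h
  obtain ⟨h0', g', hgm', hg', hi'⟩ := h'
  refine ⟨add_nonneg h0 h0', g + g', hgm.add hgm', ?_, fun π hπ => ?_⟩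
  · filter_upwards [hg, hg', Lp.coeFn_add G G', (Lp.coeFn_nonneg G).2 h0,
      (Lp.coeFn_nonneg G').2 h0'] with x e1 e2 e3 e4 e5
    rw [e3, Pi.add_apply, Pi.add_apply, e1, e2, ENNReal.ofReal_add e4 e5]
  · calc ∫⁻ γ, ‖(f + f') (γ 1) - (f + f') (γ 0)‖ₑ ∂π
        ≤ ∫⁻ γ, (‖f (γ 1) - f (γ 0)‖ₑ + ‖f' (γ 1) - f' (γ 0)‖ₑ) ∂π := by
          refine lintegral_mono_ae ?_
          filter_upwards [hπ.ae_comp (Lp.coeFn_add f f') 1, hπ.ae_comp (Lp.coeFn_add f f') 0]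
            with γ e1 e2
          rw [e1, e2, Pi.add_apply, Pi.add_apply, add_sub_add_comm]
          exact enorm_add_le _ _
      _ = ∫⁻ γ, ‖f (γ 1) - f (γ 0)‖ₑ ∂π + ∫⁻ γ, ‖f' (γ 1) - f' (γ 0)‖ₑ ∂π :=
          lintegral_add_left (measurable_increment f) _
      _ ≤ _ := add_le_add (hi π hπ) (hi' π hπ)
      _ ≤ ∫⁻ γ, ((∫⁻ t, g (γ t) * metricSpeed d γ t) + ∫⁻ t, g' (γ t) * metricSpeed d γ t) ∂π :=
          le_lintegral_add _ _
      _ ≤ _ := by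
          refine lintegral_mono fun γ => (le_lintegral_add _ _).trans (le_of_eq ?_)
          simp only [Pi.add_apply, add_mul]

theorem IsWeakUpperGradient.smul {d : X → X → ℝ} {m : Measure X} {f G : Lp ℝ 2 m} (c : ℝ)
    (h : IsWeakUpperGradient d f G) : IsWeakUpperGradient d (c • f) (|c| • G) := by
  obtain ⟨h0, g, hgm, hg, hi⟩ := h
  have h0' := (Lp.coeFn_nonneg G).2 h0
  refine ⟨?_, fun x => ENNReal.ofReal |c| * g x, hgm.const_mul _, ?_, fun π hπ => ?_⟩
  · rw [← Lp.coeFn_nonneg]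
    filter_upwards [h0', Lp.coeFn_smul |c| G] with x e1 e2
    rw [e2]
    exact mul_nonneg (abs_nonneg c) e1
  · filter_upwards [hg, Lp.coeFn_smul |c| G] with x e1 e2
    rw [e2, e1, Pi.smul_apply, smul_eq_mul, ENNReal.ofReal_mul (abs_nonneg c)]
  · calc ∫⁻ γ, ‖(c • f) (γ 1) - (c • f) (γ 0)‖ₑ ∂π
        = ∫⁻ γ, ENNReal.ofReal |c| * ‖f (γ 1) - f (γ 0)‖ₑ ∂π := by
          refine lintegral_congr_ae ?_
          filter_upwards [hπ.ae_comp (Lp.coeFn_smul c f) 1, hπ.ae_comp (Lp.coeFn_smul c f) 0]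
            with γ e1 e2
          rw [e1, e2, Pi.smul_apply, Pi.smul_apply, ← smul_sub, enorm_smul,
            Real.enorm_eq_ofReal_abs]
      _ = ENNReal.ofReal |c| * ∫⁻ γ, ‖f (γ 1) - f (γ 0)‖ₑ ∂π :=
          lintegral_const_mul _ (measurable_increment f)
      _ ≤ ENNReal.ofReal |c| * ∫⁻ γ, (∫⁻ t, g (γ t) * metricSpeed d γ t) ∂π := by
          exact mul_le_mul_right (hi π hπ) _
      _ = _ := by
          rw [← lintegral_const_mul' _ _ ENNReal.ofReal_ne_top]
          refine lintegral_congr fun γ => ?_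
          rw [← lintegral_const_mul' _ _ ENNReal.ofReal_ne_top]
          simp only [mul_assoc]

/-- The Sobolev space `W^{1,2}(X, d, m)`. -/
def sobolev (d : X → X → ℝ) (m : Measure X) : Submodule ℝ (Lp ℝ 2 m) where
  carrier := {f | ∃ G, IsWeakUpperGradient d f G}
  add_mem' := fun ⟨G, hG⟩ ⟨G', hG'⟩ => ⟨G + G', hG.add hG'⟩
  zero_mem' := ⟨0, IsWeakUpperGradient.zero d m⟩
  smul_mem' := fun c _ ⟨G, hG⟩ => ⟨|c| • G, hG.smul c⟩

theorem exists_minimalWeakUpperGradient (d : X → X → ℝ) {m : Measure X} (f : sobolev d m) :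
    ∃ G : Lp ℝ 2 m, IsGLB {G | IsWeakUpperGradient d (f : Lp ℝ 2 m) G} G :=
  exists_isGLB_Lp _ f.2 fun _ hG => hG.1

/-- The minimal weak upper gradient `|Df|`: the smallest weak upper gradient of `f` in the a.e.
order, i.e. the greatest lower bound in `L²(m)` of all the weak upper gradients. -/
def minimalWeakUpperGradient (d : X → X → ℝ) {m : Measure X} (f : sobolev d m) : Lp ℝ 2 m :=
  (exists_minimalWeakUpperGradient d f).choose

theorem isGLB_minimalWeakUpperGradient (d : X → X → ℝ) {m : Measure X} (f : sobolev d m) :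
    IsGLB {G | IsWeakUpperGradient d (f : Lp ℝ 2 m) G} (minimalWeakUpperGradient d f) :=
  (exists_minimalWeakUpperGradient d f).choose_spec

theorem isPointwiseSeminorm_minimalWeakUpperGradient (d : X → X → ℝ) (m : Measure X) :
    IsPointwiseSeminorm (fun f : sobolev d m => minimalWeakUpperGradient d f) := by
  have hnn : ∀ f : sobolev d m, 0 ≤ minimalWeakUpperGradient d f := fun f =>
    (isGLB_minimalWeakUpperGradient d f).2 fun G hG => hG.1
  have hle : ∀ (c : ℝ) (f : sobolev d m),
      minimalWeakUpperGradient d (c • f) ≤ |c| • minimalWeakUpperGradient d f := by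
    intro c f
    rcases eq_or_ne c 0 with rfl | hc
    · rw [zero_smul, abs_zero, zero_smul]
      exact (isGLB_minimalWeakUpperGradient d _).1 (IsWeakUpperGradient.zero d m)
    · have hc' : 0 < |c| := abs_pos.2 hc
      have key : |c|⁻¹ • minimalWeakUpperGradient d (c • f) ≤ minimalWeakUpperGradient d f := by
        refine (isGLB_minimalWeakUpperGradient d f).2 fun G hG => ?_
        have h1 : minimalWeakUpperGradient d (c • f) ≤ |c| • G :=
          (isGLB_minimalWeakUpperGradient d (c • f)).1 (hG.smul c)
        rw [← Lp.coeFn_le] at h1 ⊢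
        filter_upwards [h1, Lp.coeFn_smul |c| G,
          Lp.coeFn_smul |c|⁻¹ (minimalWeakUpperGradient d (c • f))] with x e1 e2 e3
        rw [e3, Pi.smul_apply, smul_eq_mul, inv_mul_le_iff₀ hc']
        rwa [e2] at e1
      rw [← Lp.coeFn_le] at key ⊢
      filter_upwards [key, Lp.coeFn_smul |c| (minimalWeakUpperGradient d f),
        Lp.coeFn_smul |c|⁻¹ (minimalWeakUpperGradient d (c • f))] with x e1 e2 e3
      rw [e3, Pi.smul_apply, smul_eq_mul, inv_mul_le_iff₀ hc'] at e1
      rwa [e2]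
  refine ⟨hnn, fun f h => ?_, fun c f => le_antisymm (hle c f) ?_⟩
  · have h1 : ∀ G, IsWeakUpperGradient d (f : Lp ℝ 2 m) G →
        minimalWeakUpperGradient d (f + h) - G ≤ minimalWeakUpperGradient d h := by
      intro G hG
      refine (isGLB_minimalWeakUpperGradient d h).2 fun G' hG' => ?_
      rw [sub_le_iff_le_add']
      exact (isGLB_minimalWeakUpperGradient d (f + h)).1 (hG.add hG')
    have h2 : minimalWeakUpperGradient d (f + h) - minimalWeakUpperGradient d h
        ≤ minimalWeakUpperGradient d f := by
      refine (isGLB_minimalWeakUpperGradient d f).2 fun G hG => ?_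
      rw [sub_le_comm]
      exact h1 G hG
    exact sub_le_iff_le_add.1 h2
  · rcases eq_or_ne c 0 with rfl | hc
    · rw [abs_zero, zero_smul]; exact hnn _
    · have h1 := hle c⁻¹ (c • f)
      rw [smul_smul, inv_mul_cancel₀ hc, one_smul, abs_inv] at h1
      have hc' : 0 < |c| := abs_pos.2 hc
      rw [← Lp.coeFn_le] at h1 ⊢
      filter_upwards [h1, Lp.coeFn_smul |c| (minimalWeakUpperGradient d f),
        Lp.coeFn_smul |c|⁻¹ (minimalWeakUpperGradient d (c • f))] with x e1 e2 e3
      rw [e3, Pi.smul_apply, smul_eq_mul, le_inv_mul_iff₀ hc'] at e1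
      rwa [e2]

end Sobolev

section Cotangent

variable {X : Type*} [TopologicalSpace X] [MeasurableSpace X] [BorelSpace X]

/-- Simple `1`-forms `∑ i, χ_{E i} df_i`, encoded by the simple function `∑ i, χ_{E i} f_i` on `X`
with values in the Sobolev space. -/
def SimpleForm (d : X → X → ℝ) (m : Measure X) : Type _ := SimpleFunc X (sobolev d m)

variable {d : X → X → ℝ} {m : Measure X}

namespace SimpleForm

instance : AddCommGroup (SimpleForm d m) := inferInstanceAs (AddCommGroup (SimpleFunc X _))

instance : Module ℝ (SimpleForm d m) := inferInstanceAs (Module ℝ (SimpleFunc X _))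

/-- The simple form with underlying simple function `s`. -/
def of (s : SimpleFunc X (sobolev d m)) : SimpleForm d m := s

/-- The value of the underlying simple function. -/
def val (ω : SimpleForm d m) (x : X) : sobolev d m := (show SimpleFunc X (sobolev d m) from ω) x

theorem val_add (ω η : SimpleForm d m) (x : X) : (ω + η).val x = ω.val x + η.val x := rfl

theorem val_smul (c : ℝ) (ω : SimpleForm d m) (x : X) : (c • ω).val x = c • ω.val x := rfl

theorem ext {ω η : SimpleForm d m} (h : ∀ x, ω.val x = η.val x) : ω = η := SimpleFunc.ext h

theorem finite_range (ω : SimpleForm d m) : (range ω.val).Finite :=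
  (show SimpleFunc X (sobolev d m) from ω).finite_range

theorem memLp (ω : SimpleForm d m) :
    MemLp (fun x => minimalWeakUpperGradient d (ω.val x) x) 2 m := by
  classical
  set s : SimpleFunc X (sobolev d m) := ω
  have h : (fun x => minimalWeakUpperGradient d (ω.val x) x) = fun x => ∑ f ∈ s.range,
      (s ⁻¹' {f}).indicator (fun y => minimalWeakUpperGradient d f y) x := by
    funext x
    rw [Finset.sum_eq_single (s x)]
    · rw [indicator_of_mem (by simp)]; rfl
    · intro f _ hf
      rw [indicator_of_notMem]
      simpa using fun h => hf h.symm
    · intro h; exact absurd (s.mem_range_self x) h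
  rw [h]
  exact memLp_finsetSum _ fun f _ => (Lp.memLp _).indicator (s.measurableSet_fiber f)

/-- The pointwise norm `∑ i, χ_{E i} |Df_i|` of `∑ i, χ_{E i} df_i`. -/
def pnorm (ω : SimpleForm d m) : Lp ℝ 2 m := ω.memLp.toLp

theorem coeFn_pnorm (ω : SimpleForm d m) :
    ω.pnorm =ᵐ[m] fun x => minimalWeakUpperGradient d (ω.val x) x := ω.memLp.coeFn_toLp

theorem isPointwiseSeminorm : IsPointwiseSeminorm (pnorm : SimpleForm d m → Lp ℝ 2 m) := by
  have hD := isPointwiseSeminorm_minimalWeakUpperGradient d m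
  refine ⟨fun ω => ?_, fun ω η => ?_, fun c ω => ?_⟩
  · rw [← Lp.coeFn_nonneg]
    have h : ∀ᵐ x ∂m, ∀ f ∈ range ω.val, 0 ≤ minimalWeakUpperGradient d f x :=
      (ae_ball_iff ω.finite_range.countable).2 fun f _ => (Lp.coeFn_nonneg _).2 (hD.nonneg f)
    filter_upwards [ω.coeFn_pnorm, h] with x h1 h2
    rw [h1]
    exact h2 _ (mem_range_self x)
  · rw [← Lp.coeFn_le]
    have h : ∀ᵐ x ∂m, ∀ f ∈ range ω.val, ∀ g ∈ range η.val, minimalWeakUpperGradient d (f + g) x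
        ≤ minimalWeakUpperGradient d f x + minimalWeakUpperGradient d g x :=
      (ae_ball_iff ω.finite_range.countable).2 fun f _ =>
        (ae_ball_iff η.finite_range.countable).2 fun g _ => by
          filter_upwards [(Lp.coeFn_le _ _).2 (hD.add_le f g), Lp.coeFn_add
            (minimalWeakUpperGradient d f) (minimalWeakUpperGradient d g)] with x h1 h2
          rw [h2] at h1; exact h1
    filter_upwards [ω.coeFn_pnorm, η.coeFn_pnorm, (ω + η).coeFn_pnorm, h,
      Lp.coeFn_add ω.pnorm η.pnorm] with x h1 h2 h3 h4 h5
    rw [h5, Pi.add_apply, h1, h2, h3]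
    exact h4 _ (mem_range_self x) _ (mem_range_self x)
  · refine Lp.ext ?_
    have h : ∀ᵐ x ∂m, ∀ f ∈ range ω.val, minimalWeakUpperGradient d (c • f) x
        = |c| * minimalWeakUpperGradient d f x :=
      (ae_ball_iff ω.finite_range.countable).2 fun f _ => by
        filter_upwards [Lp.coeFn_smul |c| (minimalWeakUpperGradient d f)] with x h1
        rw [hD.smul c f, h1]; rfl
    filter_upwards [ω.coeFn_pnorm, (c • ω).coeFn_pnorm, h, Lp.coeFn_smul |c| ω.pnorm]
      with x h1 h2 h3 h4
    rw [h4, h2, Pi.smul_apply, h1]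
    exact h3 _ (mem_range_self x)

instance : Norm (SimpleForm d m) := ⟨fun ω => ‖ω.pnorm‖⟩

theorem norm_def (ω : SimpleForm d m) : ‖ω‖ = ‖ω.pnorm‖ := rfl

instance : SeminormedAddCommGroup (SimpleForm d m) :=
  SeminormedAddCommGroup.ofCore (isPointwiseSeminorm.core (fun _ => rfl))

instance : NormedSpace ℝ (SimpleForm d m) where
  norm_smul_le c ω := ((isPointwiseSeminorm.core (fun _ => rfl)).norm_smul c ω).le

/-- Simple functions act on simple forms. -/
instance : SMul (SimpleFunc X ℝ) (SimpleForm d m) :=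
  ⟨fun s ω => (s.pair (show SimpleFunc X (sobolev d m) from ω)).map fun q => q.1 • q.2⟩

theorem val_smul' (s : SimpleFunc X ℝ) (ω : SimpleForm d m) (x : X) :
    (s • ω).val x = s x • ω.val x := rfl

instance : Module (SimpleFunc X ℝ) (SimpleForm d m) where
  one_smul ω := ext fun x => by rw [val_smul']; exact one_smul ℝ _
  mul_smul s t ω := ext fun x => by simp only [val_smul']; exact mul_smul (s x) (t x) _
  smul_zero s := ext fun x => smul_zero (s x)
  smul_add s ω η := ext fun x => smul_add (s x) (ω.val x) (η.val x)
  add_smul s t ω := ext fun x => add_smul (s x) (t x) (ω.val x)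
  zero_smul ω := ext fun x => zero_smul ℝ (ω.val x)

theorem pnorm_smul (s : SimpleFunc X ℝ) (ω : SimpleForm d m) :
    (s • ω).pnorm =ᵐ[m] fun x => |s x| * ω.pnorm x := by
  have hD := isPointwiseSeminorm_minimalWeakUpperGradient d m
  have h : ∀ᵐ x ∂m, ∀ c ∈ range s, ∀ f ∈ range ω.val, minimalWeakUpperGradient d (c • f) x
        = |c| * minimalWeakUpperGradient d f x :=
    (ae_ball_iff s.finite_range.countable).2 fun c _ =>
      (ae_ball_iff ω.finite_range.countable).2 fun f _ => by
        filter_upwards [Lp.coeFn_smul |c| (minimalWeakUpperGradient d f)] with x h1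
        rw [hD.smul c f, h1]; rfl
  filter_upwards [ω.coeFn_pnorm, (s • ω).coeFn_pnorm, h] with x h1 h2 h3
  rw [h2, h1, val_smul']
  exact h3 _ (mem_range_self x) _ (mem_range_self x)

instance : UniformContinuousConstSMul (SimpleFunc X ℝ) (SimpleForm d m) := by
  refine ⟨fun s => ?_⟩
  obtain ⟨K, hK0, hK⟩ := exists_bound s
  refine (LipschitzWith.of_dist_le_mul (K := ⟨K, hK0⟩) fun ω η => ?_).uniformContinuous
  rw [dist_eq_norm, dist_eq_norm, ← smul_sub, norm_def, norm_def]
  refine Lp.norm_le_mul_norm_of_ae_le_mul ?_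
  filter_upwards [pnorm_smul s (ω - η)] with x hx
  rw [hx, norm_mul, Real.norm_eq_abs, abs_abs]
  exact mul_le_mul_of_nonneg_right (hK x) (norm_nonneg _)

theorem uniformContinuous_pnorm :
    UniformContinuous (pnorm : SimpleForm d m → Lp ℝ 2 m) := by
  refine (LipschitzWith.of_dist_le_mul (K := 1) fun ω η => ?_).uniformContinuous
  rw [dist_eq_norm, dist_eq_norm, NNReal.coe_one, one_mul]
  exact isPointwiseSeminorm.norm_sub_le ω η

end SimpleForm

variable (d m) in
/-- The cotangent module `L²_m(T^*X)`: the completion of the space of simple `1`-forms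
`∑ i, χ_{E i} df_i` with respect to the norm `‖∑ i, χ_{E i} |Df_i|‖_{L²(m)}` (forms at distance
zero being identified). -/
abbrev CotangentModule : Type _ := UniformSpace.Completion (SimpleForm d m)

namespace CotangentModule

open UniformSpace

/-- The pointwise norm of the cotangent module, extended from simple forms by continuity. -/
def pnorm (v : CotangentModule d m) : Lp ℝ 2 m := Completion.extension SimpleForm.pnorm v

theorem continuous_pnorm : Continuous (pnorm : CotangentModule d m → Lp ℝ 2 m) :=
  Completion.continuous_extension

theorem pnorm_coe (ω : SimpleForm d m) : pnorm (ω : CotangentModule d m) = ω.pnorm :=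
  Completion.extension_coe SimpleForm.uniformContinuous_pnorm ω

theorem pnorm_nonneg (v : CotangentModule d m) : 0 ≤ pnorm v := by
  induction v using Completion.induction_on with
  | hp => exact isClosed_le continuous_const continuous_pnorm
  | ih ω => rw [pnorm_coe]; exact SimpleForm.isPointwiseSeminorm.nonneg ω

theorem norm_pnorm (v : CotangentModule d m) : ‖pnorm v‖ = ‖v‖ := by
  induction v using Completion.induction_on with
  | hp => exact isClosed_eq continuous_pnorm.norm continuous_norm
  | ih ω => rw [pnorm_coe, Completion.norm_coe]; rfl

theorem pnorm_simple_smul (s : SimpleFunc X ℝ) (v : CotangentModule d m) :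
    pnorm (s • v) =ᵐ[m] fun x => |s x| * pnorm v x := by
  have hs : MemLp s ⊤ m := by
    obtain ⟨K, -, hK⟩ := exists_bound s
    exact memLp_top_of_bound s.aestronglyMeasurable K (ae_of_all _ hK)
  obtain ⟨M, hM⟩ := exists_mulAbs hs
  have key : pnorm (s • v) = M (pnorm v) := by
    induction v using Completion.induction_on with
    | hp => exact isClosed_eq (continuous_pnorm.comp (continuous_const_smul s))
              (M.continuous.comp continuous_pnorm)
    | ih ω =>
      rw [← Completion.coe_smul, pnorm_coe, pnorm_coe]
      exact Lp.ext ((SimpleForm.pnorm_smul s ω).trans (hM _).symm)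
  rw [key]; exact hM _

theorem norm_simple_smul_le {s : SimpleFunc X ℝ} {K : ℝ} (hs : ∀ᵐ x ∂m, |s x| ≤ K)
    (v : CotangentModule d m) : ‖s • v‖ ≤ K * ‖v‖ := by
  rw [← norm_pnorm, ← norm_pnorm]
  refine Lp.norm_le_mul_norm_of_ae_le_mul ?_
  filter_upwards [hs, pnorm_simple_smul s v] with x h1 h2
  rw [h2, norm_mul, Real.norm_eq_abs, abs_abs]
  exact mul_le_mul_of_nonneg_right h1 (norm_nonneg _)

theorem const_smul (c : ℝ) (v : CotangentModule d m) : SimpleFunc.const X c • v = c • v := by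
  induction v using Completion.induction_on with
  | hp => exact isClosed_eq (continuous_const_smul _) (continuous_const_smul _)
  | ih ω => rw [← Completion.coe_smul, ← Completion.coe_smul]; rfl

theorem exists_simple_approx (a : Linfty m) {ε : ℝ} (hε : 0 < ε) :
    ∃ s : SimpleFunc X ℝ, ∀ᵐ x ∂m, |s x - (a : X →ₘ[m] ℝ) x| ≤ ε := by
  obtain ⟨K, hK0, hK⟩ := exists_ae_bound a
  have ham : Measurable ((a : X →ₘ[m] ℝ) : X → ℝ) := (AEEqFun.stronglyMeasurable _).measurable
  set b : X → ℝ := fun x => max (-K) (min ((a : X →ₘ[m] ℝ) x) K) with hb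
  have hbm : Measurable b := measurable_const.max (ham.min measurable_const)
  have hbK : ∀ x, -K ≤ b x ∧ b x ≤ K := fun x =>
    ⟨le_max_left _ _, max_le (by linarith) (min_le_right _ _)⟩
  have hfm : Measurable fun x => ⌊b x / ε⌋ := Int.measurable_floor.comp (hbm.div_const ε)
  have hfin : (range fun x => ⌊b x / ε⌋).Finite := by
    refine (finite_Icc ⌊-K / ε⌋ ⌊K / ε⌋).subset ?_
    rintro _ ⟨x, rfl⟩
    exact ⟨Int.floor_mono (by gcongr; exact (hbK x).1), Int.floor_mono (by gcongr; exact (hbK x).2)⟩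
  let r : SimpleFunc X ℤ := ⟨fun x => ⌊b x / ε⌋, fun k => hfm (measurableSet_singleton k), hfin⟩
  refine ⟨r.map fun k : ℤ => (k : ℝ) * ε, ?_⟩
  filter_upwards [hK] with x hx
  have hbx : b x = (a : X →ₘ[m] ℝ) x := by
    rw [abs_le] at hx
    simp [hb, min_eq_left hx.2, max_eq_right hx.1]
  have h1 := Int.floor_le (b x / ε)
  have h2 := (Int.lt_floor_add_one (b x / ε)).le
  rw [le_div_iff₀ hε] at h1
  rw [div_le_iff₀ hε, add_mul, one_mul] at h2
  rw [SimpleFunc.map_apply, ← hbx, abs_le]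
  change -ε ≤ (⌊b x / ε⌋ : ℝ) * ε - b x ∧ (⌊b x / ε⌋ : ℝ) * ε - b x ≤ ε
  constructor <;> linarith

/-- A sequence of simple functions converging to `a` uniformly (up to a null set). -/
def approx (a : Linfty m) (n : ℕ) : SimpleFunc X ℝ :=
  (exists_simple_approx a (ε := 1 / ((n : ℝ) + 1)) (by positivity)).choose

theorem approx_spec (a : Linfty m) (n : ℕ) :
    ∀ᵐ x ∂m, |approx a n x - (a : X →ₘ[m] ℝ) x| ≤ 1 / ((n : ℝ) + 1) :=
  (exists_simple_approx a (ε := 1 / ((n : ℝ) + 1)) (by positivity)).choose_spec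

/-- Multiplication by a function of `L^∞(m)`, extended from simple functions by continuity. -/
instance : SMul (Linfty m) (CotangentModule d m) :=
  ⟨fun a v => limUnder atTop fun n => approx a n • v⟩

theorem tendsto_approx_smul (a : Linfty m) (v : CotangentModule d m) :
    Tendsto (fun n => approx a n • v) atTop (𝓝 (a • v)) := by
  refine CauchySeq.tendsto_limUnder (cauchySeq_of_le_tendsto_0
    (fun N : ℕ => (2 * (1 / ((N : ℝ) + 1))) * ‖v‖) (fun n k N hn hk => ?_) ?_)
  · rw [dist_eq_norm, ← sub_smul]
    refine norm_simple_smul_le ?_ v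
    filter_upwards [approx_spec a n, approx_spec a k] with x h1 h2
    have e1 : 1 / ((n : ℝ) + 1) ≤ 1 / ((N : ℝ) + 1) := by gcongr
    have e2 : 1 / ((k : ℝ) + 1) ≤ 1 / ((N : ℝ) + 1) := by gcongr
    rw [SimpleFunc.sub_apply]
    rw [abs_le] at h1 h2 ⊢
    constructor <;> linarith [h1.1, h1.2, h2.1, h2.2]
  · have := ((tendsto_one_div_add_atTop_nhds_zero_nat (𝕜 := ℝ)).const_mul 2).mul_const ‖v‖
    simpa using this

theorem tendsto_smul {a : Linfty m} {t : ℕ → SimpleFunc X ℝ} {ε : ℕ → ℝ}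
    (hε : Tendsto ε atTop (𝓝 0)) (ht : ∀ n, ∀ᵐ x ∂m, |t n x - (a : X →ₘ[m] ℝ) x| ≤ ε n)
    (v : CotangentModule d m) : Tendsto (fun n => t n • v) atTop (𝓝 (a • v)) := by
  have h1 : Tendsto (fun n => t n • v - approx a n • v) atTop (𝓝 0) := by
    refine squeeze_zero_norm (a := fun n => (ε n + 1 / ((n : ℝ) + 1)) * ‖v‖) (fun n => ?_) ?_
    · rw [← sub_smul]
      refine norm_simple_smul_le ?_ v
      filter_upwards [approx_spec a n, ht n] with x h1 h2
      rw [SimpleFunc.sub_apply]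
      rw [abs_le] at h1 h2 ⊢
      constructor <;> linarith [h1.1, h1.2, h2.1, h2.2]
    · simpa using (hε.add (tendsto_one_div_add_atTop_nhds_zero_nat (𝕜 := ℝ))).mul_const ‖v‖
  simpa using h1.add (tendsto_approx_smul a v)

theorem pnorm_smul (a : Linfty m) (v : CotangentModule d m) :
    pnorm (a • v) =ᵐ[m] fun x => |(a : X →ₘ[m] ℝ) x| * pnorm v x := by
  obtain ⟨M, hM⟩ := exists_mulAbs (Linfty.memLp a)
  have h1 : Tendsto (fun n => pnorm (approx a n • v)) atTop (𝓝 (pnorm (a • v))) :=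
    (continuous_pnorm.tendsto _).comp (tendsto_approx_smul a v)
  have h2 : Tendsto (fun n => pnorm (approx a n • v) - M (pnorm v)) atTop (𝓝 0) := by
    refine squeeze_zero_norm (a := fun n : ℕ => 1 / ((n : ℝ) + 1) * ‖pnorm v‖) (fun n => ?_) ?_
    · refine Lp.norm_le_mul_norm_of_ae_le_mul ?_
      filter_upwards [approx_spec a n, pnorm_simple_smul (approx a n) v, hM (pnorm v),
        Lp.coeFn_sub (pnorm (approx a n • v)) (M (pnorm v))] with x e1 e2 e3 e4
      rw [e4, Pi.sub_apply, e2, e3, ← sub_mul, norm_mul, Real.norm_eq_abs]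
      exact mul_le_mul_of_nonneg_right ((abs_abs_sub_abs_le_abs_sub _ _).trans e1) (norm_nonneg _)
    · simpa using (tendsto_one_div_add_atTop_nhds_zero_nat (𝕜 := ℝ)).mul_const ‖pnorm v‖
  have h3 := h2.add_const (M (pnorm v))
  simp only [sub_add_cancel, zero_add] at h3
  rw [tendsto_nhds_unique h1 h3]
  exact hM _

instance : Module (Linfty m) (CotangentModule d m) where
  one_smul v := by
    have h := tendsto_smul (a := (1 : Linfty m)) (t := fun _ => 1) (ε := fun _ => 0)
      tendsto_const_nhds (fun n => by
        filter_upwards [AEEqFun.coeFn_one (β := ℝ) (μ := m)] with x hx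
        have : (((1 : Linfty m) : X →ₘ[m] ℝ) : X → ℝ) x = 1 := hx
        rw [this]; simp) v
    simp only [one_smul] at h
    exact (tendsto_nhds_unique h tendsto_const_nhds)
  mul_smul a b v := by
    obtain ⟨Ka, hKa0, hKa⟩ := exists_ae_bound a
    obtain ⟨Kb, hKb0, hKb⟩ := exists_ae_bound b
    have hz := tendsto_one_div_add_atTop_nhds_zero_nat (𝕜 := ℝ)
    have h1 : Tendsto (fun n => (approx a n * approx b n) • v) atTop (𝓝 ((a * b) • v)) := by
      refine tendsto_smul (ε := fun n : ℕ => (Ka + 1) * (1 / ((n : ℝ) + 1))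
        + Kb * (1 / ((n : ℝ) + 1))) ?_ (fun n => ?_) v
      · simpa using (hz.const_mul (Ka + 1)).add (hz.const_mul Kb)
      · filter_upwards [approx_spec a n, approx_spec b n, hKa, hKb,
          AEEqFun.coeFn_mul (a : X →ₘ[m] ℝ) (b : X →ₘ[m] ℝ)] with x e1 e2 e3 e4 e5
        have e6 : (((a * b : Linfty m) : X →ₘ[m] ℝ) : X → ℝ) x
            = (a : X →ₘ[m] ℝ) x * (b : X →ₘ[m] ℝ) x := e5
        have e7 : 1 / ((n : ℝ) + 1) ≤ 1 := by
          rw [div_le_one (by positivity)]; linarith [(n.cast_nonneg : (0 : ℝ) ≤ n)]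
        have e8 : |approx a n x| ≤ Ka + 1 := by
          rw [abs_le] at e1 e3 ⊢
          constructor <;> linarith [e1.1, e1.2, e3.1, e3.2]
        have e9 : (approx a n * approx b n) x - (a : X →ₘ[m] ℝ) x * (b : X →ₘ[m] ℝ) x
            = approx a n x * (approx b n x - (b : X →ₘ[m] ℝ) x)
              + (b : X →ₘ[m] ℝ) x * (approx a n x - (a : X →ₘ[m] ℝ) x) := by
          rw [SimpleFunc.mul_apply]; ring
        rw [e6, e9]
        refine (abs_add_le _ _).trans (add_le_add ?_ ?_)
        · rw [abs_mul]; exact mul_le_mul e8 e2 (abs_nonneg _) (by positivity)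
        · rw [abs_mul]; exact mul_le_mul e4 e1 (abs_nonneg _) hKb0
    have h2 : Tendsto (fun n => approx a n • (approx b n • v) - approx a n • (b • v)) atTop
        (𝓝 0) := by
      refine squeeze_zero_norm (a := fun n => (Ka + 1) * ‖approx b n • v - b • v‖)
        (fun n => ?_) ?_
      · rw [← smul_sub]
        refine norm_simple_smul_le ?_ _
        filter_upwards [approx_spec a n, hKa] with x e1 e3
        have e7 : 1 / ((n : ℝ) + 1) ≤ 1 := by
          rw [div_le_one (by positivity)]; linarith [(n.cast_nonneg : (0 : ℝ) ≤ n)]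
        rw [abs_le] at e1 e3 ⊢
        constructor <;> linarith [e1.1, e1.2, e3.1, e3.2]
      · have := (((tendsto_approx_smul b v).sub_const (b • v)).norm).const_mul (Ka + 1)
        simpa using this
    have h3 := h2.add (tendsto_approx_smul a (b • v))
    simp only [sub_add_cancel, zero_add, ← mul_smul] at h3
    exact tendsto_nhds_unique h1 h3
  smul_zero a := by
    have h := tendsto_approx_smul a (0 : CotangentModule d m)
    simp only [smul_zero] at h
    exact (tendsto_nhds_unique h tendsto_const_nhds)
  smul_add a v w := by
    have h := tendsto_approx_smul a (v + w)
    simp only [smul_add] at h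
    exact tendsto_nhds_unique h ((tendsto_approx_smul a v).add (tendsto_approx_smul a w))
  add_smul a b v := by
    have hz := tendsto_one_div_add_atTop_nhds_zero_nat (𝕜 := ℝ)
    have h1 : Tendsto (fun n => (approx a n + approx b n) • v) atTop (𝓝 ((a + b) • v)) := by
      refine tendsto_smul (ε := fun n : ℕ => 1 / ((n : ℝ) + 1) + 1 / ((n : ℝ) + 1)) ?_
        (fun n => ?_) v
      · simpa using hz.add hz
      · filter_upwards [approx_spec a n, approx_spec b n,
          AEEqFun.coeFn_add (a : X →ₘ[m] ℝ) (b : X →ₘ[m] ℝ)] with x e1 e2 e5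
        have e6 : (((a + b : Linfty m) : X →ₘ[m] ℝ) : X → ℝ) x
            = (a : X →ₘ[m] ℝ) x + (b : X →ₘ[m] ℝ) x := e5
        rw [e6, SimpleFunc.add_apply, add_sub_add_comm]
        exact (abs_add_le _ _).trans (add_le_add e1 e2)
    simp only [add_smul] at h1
    exact tendsto_nhds_unique h1 ((tendsto_approx_smul a v).add (tendsto_approx_smul b v))
  zero_smul v := by
    have h := tendsto_smul (a := (0 : Linfty m)) (t := fun _ => 0) (ε := fun _ => 0)
      tendsto_const_nhds (fun n => by
        filter_upwards [AEEqFun.coeFn_zero (β := ℝ) (μ := m)] with x hx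
        have : (((0 : Linfty m) : X →ₘ[m] ℝ) : X → ℝ) x = 0 := hx
        rw [this]; simp) v
    simp only [zero_smul] at h
    exact (tendsto_nhds_unique h tendsto_const_nhds)

instance : IsScalarTower ℝ (Linfty m) (CotangentModule d m) where
  smul_assoc c a v := by
    have h1 : Tendsto (fun n => (SimpleFunc.const X c * approx a n) • v) atTop
        (𝓝 ((c • a) • v)) := by
      refine tendsto_smul (ε := fun n : ℕ => |c| * (1 / ((n : ℝ) + 1))) ?_ (fun n => ?_) v
      · simpa using (tendsto_one_div_add_atTop_nhds_zero_nat (𝕜 := ℝ)).const_mul |c|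
      · filter_upwards [approx_spec a n, AEEqFun.coeFn_smul c (a : X →ₘ[m] ℝ)] with x e1 e5
        have e6 : (((c • a : Linfty m) : X →ₘ[m] ℝ) : X → ℝ) x = c * (a : X →ₘ[m] ℝ) x := e5
        rw [e6, SimpleFunc.mul_apply, SimpleFunc.const_apply, ← mul_sub, abs_mul]
        exact mul_le_mul_of_nonneg_left e1 (abs_nonneg c)
    simp only [mul_smul, const_smul] at h1
    exact tendsto_nhds_unique h1 ((tendsto_approx_smul a v).const_smul c)

instance : L2NormedModule m (CotangentModule d m) where
  pnorm := pnorm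
  pnorm_nonneg := pnorm_nonneg
  norm_pnorm := norm_pnorm
  pnorm_smul := pnorm_smul

variable (d m) in
/-- The differential `df` of a Sobolev function. -/
def differential : sobolev d m →ₗ[ℝ] CotangentModule d m where
  toFun f := (SimpleForm.of (SimpleFunc.const X f) : CotangentModule d m)
  map_add' f g := by rw [← Completion.coe_add]; rfl
  map_smul' c f := by rw [RingHom.id_apply, ← Completion.coe_smul]; rfl

/-- First defining property of the cotangent module: `|df| = |Df|`. -/
theorem pnorm_differential (f : sobolev d m) :
    L2NormedModule.pnorm (differential d m f) = minimalWeakUpperGradient d f := by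
  refine (pnorm_coe _).trans (Lp.ext ?_)
  exact SimpleForm.coeFn_pnorm _

/-- Second defining property of the cotangent module: the differentials generate it, i.e. their
`L^∞(m)`-linear combinations are dense. -/
theorem dense_span_differential :
    Dense (Submodule.span (Linfty m) (range (differential d m)) : Set (CotangentModule d m)) := by
  classical
  have hs : ∀ s : SimpleFunc X ℝ, ∃ a : Linfty m, ∀ v : CotangentModule d m, s • v = a • v := by
    intro s
    obtain ⟨K, -, hK⟩ := exists_bound s
    have hsm : MemLp s ⊤ m := memLp_top_of_bound s.aestronglyMeasurable K (ae_of_all _ hK)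
    refine ⟨⟨AEEqFun.mk s s.aestronglyMeasurable, ?_⟩, fun v => ?_⟩
    · change eLpNorm (AEEqFun.mk s s.aestronglyMeasurable : X →ₘ[m] ℝ) ⊤ m < ⊤
      rw [eLpNorm_congr_ae (AEEqFun.coeFn_mk _ _)]
      exact hsm.2
    · refine tendsto_nhds_unique tendsto_const_nhds
        (tendsto_smul (t := fun _ => s) (ε := fun _ => 0) tendsto_const_nhds (fun n => ?_) v)
      filter_upwards [AEEqFun.coeFn_mk (μ := m) s s.aestronglyMeasurable] with x hx
      rw [hx]; simp
  have hsub : range ((↑) : SimpleForm d m → CotangentModule d m) ⊆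
      Submodule.span (Linfty m) (range (differential d m)) := by
    rintro _ ⟨ω, rfl⟩
    set s : SimpleFunc X (sobolev d m) := ω
    let valHom : X → SimpleForm d m →+ sobolev d m := fun x =>
      { toFun := fun η => η.val x, map_zero' := rfl, map_add' := fun _ _ => rfl }
    have h : ω = ∑ f ∈ s.range, ((SimpleFunc.const X (1 : ℝ)).restrict (s ⁻¹' {f})) •
        SimpleForm.of (SimpleFunc.const X f) := by
      refine SimpleForm.ext fun x => ?_
      change valHom x ω = valHom x _
      rw [map_sum, Finset.sum_eq_single (s x)]
      · change s x = ((SimpleFunc.const X (1 : ℝ)).restrict (s ⁻¹' {s x})) x • s x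
        rw [SimpleFunc.restrict_apply _ (s.measurableSet_fiber _), indicator_of_mem (by simp)]
        simp
      · intro f _ hf
        change ((SimpleFunc.const X (1 : ℝ)).restrict (s ⁻¹' {f})) x • f = 0
        rw [SimpleFunc.restrict_apply _ (s.measurableSet_fiber _), indicator_of_notMem, zero_smul]
        simpa using fun h => hf h.symm
      · intro h; exact absurd (s.mem_range_self x) h
    let coeHom : SimpleForm d m →+ CotangentModule d m :=
      { toFun := (↑), map_zero' := Completion.coe_zero, map_add' := Completion.coe_add }
    change coeHom ω ∈ _
    rw [h, map_sum]
    refine Submodule.sum_mem _ fun f _ => ?_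
    change ((_ : SimpleForm d m) : CotangentModule d m) ∈ _
    rw [Completion.coe_smul]
    obtain ⟨a, ha⟩ := hs ((SimpleFunc.const X (1 : ℝ)).restrict (s ⁻¹' {f}))
    rw [ha]
    exact Submodule.smul_mem _ _ (Submodule.subset_span ⟨f, rfl⟩)
  exact Completion.denseRange_coe.mono hsub

end CotangentModule

end Cotangent

section Finsler

/-- Minkowski norms on a finite-dimensional real vector space. -/
structure IsMinkowskiNorm {V : Type*} [NormedAddCommGroup V] [NormedSpace ℝ V] (N : V → ℝ) :
    Prop where
  nonneg : ∀ v, 0 ≤ N v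
  eq_zero_iff : ∀ v, N v = 0 ↔ v = 0
  add_le : ∀ v w, N (v + w) ≤ N v + N w
  homogeneous : ∀ (c : ℝ) v, 0 ≤ c → N (c • v) = c * N v
  continuous : Continuous N
  smooth : ContDiffOn ℝ ((⊤ : ℕ∞) : WithTop ℕ∞) N {0}ᶜ
  strongly_convex : ∀ v, v ≠ 0 → ∀ w, w ≠ 0 →
    0 < (1 / 2 : ℝ) * fderiv ℝ (fderiv ℝ fun u => N u ^ 2) v w w

variable {E : Type*} [NormedAddCommGroup E] [NormedSpace ℝ E]
  {M : Type*} [TopologicalSpace M] [ChartedSpace E M]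

variable (E) in
/-- Piecewise `C¹` curves on `[0,1]` (the values of `γ` outside `[0,1]` are irrelevant). -/
def IsPiecewiseC1 (γ : ℝ → M) : Prop :=
  ContinuousOn γ (Icc 0 1) ∧ ∃ (k : ℕ) (t : ℕ → ℝ), Monotone t ∧ t 0 = 0 ∧ t k = 1 ∧
    ∀ i < k, ContMDiffOn 𝓘(ℝ) 𝓘(ℝ, E) 1 γ (Icc (t i) (t (i + 1)))

variable (E) in
/-- The differential of a real function on `M`, as a section of the cotangent bundle. -/
def diff (f : M → ℝ) (x : M) : TangentSpace 𝓘(ℝ, E) x →L[ℝ] ℝ :=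
  (NormedSpace.fromTangentSpace (𝕜 := ℝ) (f x)).toContinuousLinearMap.comp
    (mfderiv 𝓘(ℝ, E) 𝓘(ℝ) f x)

variable (E M) in
/-- The space `C¹_c(M)` of compactly supported functions of class `C¹`. -/
structure C1c where
  toFun : M → ℝ
  contMDiff : ContMDiff 𝓘(ℝ, E) 𝓘(ℝ) 1 toFun
  hasCompactSupport : HasCompactSupport toFun

variable [IsManifold 𝓘(ℝ, E) ((⊤ : ℕ∞) : WithTop ℕ∞) M]

variable (E M) in
/-- Finsler structures on a smooth manifold `M` modelled on `E`. (As a vector space with a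
topology, the tangent space `T_x M` is `E` itself, read in a preferred chart at `x`.) -/
structure FinslerStructure where
  toFun : ∀ x : M, TangentSpace 𝓘(ℝ, E) x → ℝ
  continuous_toFun : Continuous fun p : TangentBundle 𝓘(ℝ, E) M => toFun p.proj p.snd
  smooth_toFun : ContMDiffOn 𝓘(ℝ, E).tangent 𝓘(ℝ) ((⊤ : ℕ∞) : WithTop ℕ∞)
    (fun p : TangentBundle 𝓘(ℝ, E) M => toFun p.proj p.snd) {p | p.snd ≠ 0}
  isMinkowskiNorm : ∀ x, IsMinkowskiNorm (V := E) (toFun x)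

namespace FinslerStructure

instance : CoeFun (FinslerStructure E M) fun _ => ∀ x : M, TangentSpace 𝓘(ℝ, E) x → ℝ :=
  ⟨FinslerStructure.toFun⟩

/-- Reversibility: each `F(x, ·)` is symmetric. -/
def IsReversible (F : FinslerStructure E M) : Prop :=
  ∀ (x : M) (v : TangentSpace 𝓘(ℝ, E) x), F x (-v) = F x v

end FinslerStructure


namespace FinslerStructure

theorem continuousOn_symmL (x₀ : M) :
    ContinuousOn (fun z : M × E =>
      (⟨z.1, (trivializationAt E (TangentSpace 𝓘(ℝ, E)) x₀).symmL ℝ z.1 z.2⟩ :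
        TangentBundle 𝓘(ℝ, E) M))
      ((trivializationAt E (TangentSpace 𝓘(ℝ, E)) x₀).baseSet ×ˢ univ) := by
  refine (trivializationAt E (TangentSpace 𝓘(ℝ, E)) x₀).continuousOn_symm.congr fun z hz => ?_
  exact congrArg (fun w => (⟨z.1, w⟩ : TangentBundle 𝓘(ℝ, E) M))
    (Bundle.Trivialization.symmL_apply _ (mem_prod.1 hz).1 z.2)

/-- The Finsler length `∫₀¹ F(γ_t, γ'_t) dt`. -/
def length (F : FinslerStructure E M) (γ : ℝ → M) : ℝ :=
  ∫ t in (0 : ℝ)..1, F (γ t) (mfderiv 𝓘(ℝ) 𝓘(ℝ, E) γ t (1 : ℝ))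

/-- The Finsler distance. -/
def dist (F : FinslerStructure E M) (x y : M) : ℝ :=
  sInf {l | ∃ γ : ℝ → M, IsPiecewiseC1 E γ ∧ γ 0 = x ∧ γ 1 = y ∧ l = F.length γ}

/-- The dual norm `F^*(x, ω) = sup_v |ω(v)| / F(x, v)` of a covector at `x` (with `0 / 0 = 0`). -/
def dualNorm (F : FinslerStructure E M) (x : M) (ω : TangentSpace 𝓘(ℝ, E) x →L[ℝ] ℝ) : ℝ :=
  ⨆ v : TangentSpace 𝓘(ℝ, E) x, |ω v| / F x v

variable (F : FinslerStructure E M)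

theorem nonneg (x : M) (v : TangentSpace 𝓘(ℝ, E) x) : 0 ≤ F x v := (F.isMinkowskiNorm x).nonneg v

theorem pos {x : M} {v : TangentSpace 𝓘(ℝ, E) x} (hv : v ≠ 0) : 0 < F x v :=
  (F.nonneg x v).lt_of_ne fun h => hv (((F.isMinkowskiNorm x).eq_zero_iff v).1 h.symm)

theorem map_zero (x : M) : F x 0 = 0 := ((F.isMinkowskiNorm x).eq_zero_iff 0).2 rfl

theorem dualNorm_smul (x : M) (c : ℝ) (ω : TangentSpace 𝓘(ℝ, E) x →L[ℝ] ℝ) :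
    F.dualNorm x (c • ω) = |c| * F.dualNorm x ω := by
  rw [dualNorm, dualNorm, Real.mul_iSup_of_nonneg (abs_nonneg c)]
  refine iSup_congr fun v => ?_
  rw [_root_.smul_apply, smul_eq_mul, abs_mul, mul_div_assoc]

theorem dualNorm_nonneg (x : M) (ω : TangentSpace 𝓘(ℝ, E) x →L[ℝ] ℝ) : 0 ≤ F.dualNorm x ω :=
  Real.iSup_nonneg fun v => div_nonneg (abs_nonneg _) (F.nonneg x v)

theorem dualNorm_le {x : M} {ω : TangentSpace 𝓘(ℝ, E) x →L[ℝ] ℝ} {C : ℝ} (hC : 0 ≤ C)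
    (h : ∀ v, |ω v| ≤ C * F x v) : F.dualNorm x ω ≤ C :=
  ciSup_le fun v => div_le_of_le_mul₀ (F.nonneg x v) hC (h v)

variable [FiniteDimensional ℝ E]

theorem exists_le (x : M) (ω : TangentSpace 𝓘(ℝ, E) x →L[ℝ] ℝ) :
    ∃ C, 0 ≤ C ∧ ∀ v, |ω v| ≤ C * F x v := by
  let N : E → ℝ := F x
  let φ : E →L[ℝ] ℝ := ω
  have hN : IsMinkowskiNorm N := F.isMinkowskiNorm x
  have hpos : ∀ v : E, v ≠ 0 → 0 < N v := fun v hv => F.pos hv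
  have hcont : ContinuousOn (fun v : E => |φ v| / N v) (Metric.sphere 0 1) :=
    (φ.continuous.abs.continuousOn).div hN.continuous.continuousOn fun v hv =>
      (hpos v (by rintro rfl; simp at hv)).ne'
  obtain ⟨C, hC⟩ := (isCompact_sphere (0 : E) 1).bddAbove_image hcont
  suffices h : ∀ v : E, |φ v| ≤ max C 0 * N v from ⟨max C 0, le_max_right _ _, fun v => h v⟩
  intro v
  rcases eq_or_ne v 0 with rfl | hv
  · rw [_root_.map_zero, abs_zero]
    exact mul_nonneg (le_max_right _ _) (hN.nonneg _)
  · have hn : 0 < ‖v‖ := norm_pos_iff.2 hv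
    set u : E := ‖v‖⁻¹ • v with hu
    have hu1 : u ∈ Metric.sphere (0 : E) 1 := by
      rw [mem_sphere_zero_iff_norm, hu, norm_smul, norm_inv, norm_norm, inv_mul_cancel₀ hn.ne']
    have h1 : |φ u| / N u ≤ C := hC ⟨u, hu1, rfl⟩
    have h2 : |φ u| = ‖v‖⁻¹ * |φ v| := by
      rw [hu, map_smul, smul_eq_mul, abs_mul, abs_of_pos (inv_pos.2 hn)]
    have h3 : N u = ‖v‖⁻¹ * N v := hN.homogeneous _ _ (inv_pos.2 hn).le
    rw [h2, h3, mul_div_mul_left _ _ (inv_pos.2 hn).ne', div_le_iff₀ (hpos v hv)] at h1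
    exact h1.trans (mul_le_mul_of_nonneg_right (le_max_left _ _) (hN.nonneg _))

theorem bddAbove_dualNorm (x : M) (ω : TangentSpace 𝓘(ℝ, E) x →L[ℝ] ℝ) :
    BddAbove (range fun v : TangentSpace 𝓘(ℝ, E) x => |ω v| / F x v) := by
  obtain ⟨C, hC0, hC⟩ := F.exists_le x ω
  refine ⟨C, ?_⟩
  rintro _ ⟨v, rfl⟩
  exact div_le_of_le_mul₀ (F.nonneg x v) hC0 (hC v)

theorem abs_le_dualNorm_mul (x : M) (ω : TangentSpace 𝓘(ℝ, E) x →L[ℝ] ℝ)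
    (v : TangentSpace 𝓘(ℝ, E) x) : |ω v| ≤ F.dualNorm x ω * F x v := by
  rcases eq_or_ne v 0 with rfl | hv
  · rw [_root_.map_zero, abs_zero]
    exact mul_nonneg (F.dualNorm_nonneg x ω) (F.nonneg x 0)
  · rw [← div_le_iff₀ (F.pos hv)]
    exact le_ciSup (F.bddAbove_dualNorm x ω) v

theorem dualNorm_add_le (x : M) (ω η : TangentSpace 𝓘(ℝ, E) x →L[ℝ] ℝ) :
    F.dualNorm x (ω + η) ≤ F.dualNorm x ω + F.dualNorm x η := by
  refine F.dualNorm_le (add_nonneg (F.dualNorm_nonneg _ _) (F.dualNorm_nonneg _ _)) fun v => ?_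
  rw [add_mul]
  exact (abs_add_le _ _).trans
    (add_le_add (F.abs_le_dualNorm_mul x ω v) (F.abs_le_dualNorm_mul x η v))

theorem dualNorm_eq_zero_iff (x : M) (ω : TangentSpace 𝓘(ℝ, E) x →L[ℝ] ℝ) :
    F.dualNorm x ω = 0 ↔ ω = 0 := by
  constructor
  · intro h
    ext v
    have := F.abs_le_dualNorm_mul x ω v
    rw [h, zero_mul] at this
    simpa using abs_eq_zero.1 (le_antisymm this (abs_nonneg _))
  · rintro rfl
    simp [dualNorm]

end FinslerStructure

variable [FiniteDimensional ℝ E] [MeasurableSpace M]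

/-- Measurability of a (not necessarily continuous) section of the cotangent bundle: its
coefficients in the charts of the atlas are measurable. (The vector field
`x ↦ (trivializationAt E _ x₀).symmL ℝ x v` is the constant vector field `v` in the chart at `x₀`,
extended by `0` outside the domain of the chart.) -/
def IsMeasurableSection (ω : ∀ x : M, TangentSpace 𝓘(ℝ, E) x →L[ℝ] ℝ) : Prop :=
  ∀ (x₀ : M) (v : E), Measurable fun x =>
    ω x ((trivializationAt E (TangentSpace 𝓘(ℝ, E)) x₀).symmL ℝ x v)

variable [BorelSpace M] [SecondCountableTopology M]

namespace FinslerStructure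

variable (F : FinslerStructure E M)

theorem measurable_dualNorm {ω : ∀ x : M, TangentSpace 𝓘(ℝ, E) x →L[ℝ] ℝ}
    (hω : IsMeasurableSection ω) : Measurable fun x => F.dualNorm x (ω x) := by
  set Φ : M → M → ℝ := fun x₀ x => ⨆ n : ℕ,
    |ω x ((trivializationAt E (TangentSpace 𝓘(ℝ, E)) x₀).symmL ℝ x (TopologicalSpace.denseSeq E n))| /
      F x ((trivializationAt E (TangentSpace 𝓘(ℝ, E)) x₀).symmL ℝ x
        (TopologicalSpace.denseSeq E n)) with hΦ
  have hF : ∀ x₀ v, Measurable fun x =>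
      F x ((trivializationAt E (TangentSpace 𝓘(ℝ, E)) x₀).symmL ℝ x v) := by
    intro x₀ v
    classical
    set U := (trivializationAt E (TangentSpace 𝓘(ℝ, E)) x₀).baseSet with hU
    have hUo : IsOpen U := (trivializationAt E (TangentSpace 𝓘(ℝ, E)) x₀).open_baseSet
    have h1 : ContinuousOn (fun x =>
        F x ((trivializationAt E (TangentSpace 𝓘(ℝ, E)) x₀).symmL ℝ x v)) U :=
      (F.continuous_toFun.comp_continuousOn (continuousOn_symmL x₀)).comp
        (f := fun x => (x, v)) (by fun_prop) fun x hx => ⟨hx, trivial⟩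
    have h2 : (fun x => F x ((trivializationAt E (TangentSpace 𝓘(ℝ, E)) x₀).symmL ℝ x v)) =
        U.piecewise (fun x => F x ((trivializationAt E (TangentSpace 𝓘(ℝ, E)) x₀).symmL ℝ x v))
          fun _ => 0 := by
      funext x
      by_cases hx : x ∈ U
      · rw [piecewise_eq_of_mem _ _ _ hx]
      · rw [piecewise_eq_of_notMem _ _ _ hx,
          Bundle.Trivialization.symmL_apply_of_notMem _ hx, F.map_zero]
    rw [h2]
    exact h1.measurable_piecewise continuousOn_const hUo.measurableSet
  have hΦm : ∀ x₀, Measurable (Φ x₀) := fun x₀ =>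
    Measurable.iSup fun n => ((hω x₀ _).abs).div (hF x₀ _)
  have hΦeq : ∀ x₀, ∀ x ∈ (trivializationAt E (TangentSpace 𝓘(ℝ, E)) x₀).baseSet,
      F.dualNorm x (ω x) = Φ x₀ x := by
    intro x₀ x hx
    set e := trivializationAt E (TangentSpace 𝓘(ℝ, E)) x₀ with he
    let L : E →L[ℝ] TangentSpace 𝓘(ℝ, E) x := e.symmL ℝ x
    have hbdd : BddAbove (range fun n => |ω x (L (TopologicalSpace.denseSeq E n))| /
        F x (L (TopologicalSpace.denseSeq E n))) := by
      refine (F.bddAbove_dualNorm x (ω x)).mono ?_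
      rintro _ ⟨n, rfl⟩
      exact ⟨_, rfl⟩
    have hnn : ∀ v, 0 ≤ |ω x v| / F x v := fun v => div_nonneg (abs_nonneg _) (F.nonneg x v)
    refine le_antisymm (ciSup_le fun v => ?_) (ciSup_le fun n =>
      le_ciSup (F.bddAbove_dualNorm x (ω x)) (L (TopologicalSpace.denseSeq E n)))
    rcases eq_or_ne v 0 with rfl | hv
    · rw [_root_.map_zero, abs_zero, zero_div]
      exact Real.iSup_nonneg fun n => hnn _
    · obtain ⟨u, rfl⟩ : ∃ u, L u = v := ⟨_, e.symmL_continuousLinearMapAt (R := ℝ) hx v⟩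
      refine le_of_forall_lt fun S hS => ?_
      have hNc : Continuous fun w : E => F x (L w) :=
        ((F.isMinkowskiNorm x).continuous).comp L.continuous
      have hφc : Continuous fun w : E => |ω x (L w)| := ((ω x).comp L).continuous.abs
      have hc : ContinuousAt (fun w : E => |ω x (L w)| / F x (L w)) u :=
        hφc.continuousAt.div hNc.continuousAt (F.pos hv).ne'
      obtain ⟨_, ⟨n, rfl⟩, hw⟩ := (TopologicalSpace.denseRange_denseSeq E).inter_nhds_nonempty
        (hc.eventually (lt_mem_nhds hS))
      exact lt_of_lt_of_le hw (le_ciSup hbdd n)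
  obtain ⟨s, hs, hcov⟩ := TopologicalSpace.countable_cover_nhds (α := M)
    (f := fun x₀ => (trivializationAt E (TangentSpace 𝓘(ℝ, E)) x₀).baseSet) fun x =>
    (trivializationAt E (TangentSpace 𝓘(ℝ, E)) x).open_baseSet.mem_nhds
      (FiberBundle.mem_baseSet_trivializationAt' x)
  intro A hA
  have : (fun x => F.dualNorm x (ω x)) ⁻¹' A =
      ⋃ x₀ ∈ s, ((trivializationAt E (TangentSpace 𝓘(ℝ, E)) x₀).baseSet ∩ Φ x₀ ⁻¹' A) := by
    ext x
    simp only [mem_preimage, mem_iUnion, mem_inter_iff, exists_prop]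
    constructor
    · intro hx
      have : x ∈ ⋃ x₀ ∈ s, (trivializationAt E (TangentSpace 𝓘(ℝ, E)) x₀).baseSet := by
        rw [hcov]; trivial
      simp only [mem_iUnion, exists_prop] at this
      obtain ⟨x₀, h1, h2⟩ := this
      exact ⟨x₀, h1, h2, by rwa [← hΦeq x₀ x h2]⟩
    · rintro ⟨x₀, -, h2, h3⟩
      rwa [hΦeq x₀ x h2]
  rw [this]
  exact MeasurableSet.biUnion hs fun x₀ _ =>
    (trivializationAt E (TangentSpace 𝓘(ℝ, E)) x₀).open_baseSet.measurableSet.inter (hΦm x₀ hA)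


variable (μ : Measure M)

/-- The vector space of measurable sections `ω` of `T^*M` with `∫ F^*(x, ω(x))² dμ(x) < ∞`. -/
def l2Sections : Submodule ℝ (∀ x : M, TangentSpace 𝓘(ℝ, E) x →L[ℝ] ℝ) where
  carrier := {ω | IsMeasurableSection ω ∧ MemLp (fun x => F.dualNorm x (ω x)) 2 μ}
  zero_mem' := by
    refine ⟨fun x₀ v => ?_, ?_⟩
    · simp
    · have : (fun x : M => F.dualNorm x ((0 : ∀ x : M, TangentSpace 𝓘(ℝ, E) x →L[ℝ] ℝ) x)) =
          fun _ => 0 := funext fun x => (F.dualNorm_eq_zero_iff x _).2 rfl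
      rw [this]; exact MemLp.zero'
  add_mem' := fun {ω η} hω hη => by
    have hm : IsMeasurableSection (ω + η) := fun x₀ v => (hω.1 x₀ v).add (hη.1 x₀ v)
    refine ⟨hm, (hω.2.add hη.2).mono (F.measurable_dualNorm hm).aestronglyMeasurable
      (ae_of_all _ fun x => ?_)⟩
    rw [Real.norm_of_nonneg (F.dualNorm_nonneg _ _)]
    exact (F.dualNorm_add_le x (ω x) (η x)).trans (le_abs_self _)
  smul_mem' := fun c ω hω => by
    refine ⟨fun x₀ v => (hω.1 x₀ v).const_mul c, ?_⟩
    have : (fun x => F.dualNorm x ((c • ω) x)) = fun x => |c| * F.dualNorm x (ω x) :=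
      funext fun x => F.dualNorm_smul x c (ω x)
    rw [this]; exact hω.2.const_mul _

/-- The space of `l2Sections`, with its seminorm. -/
def L2Sections : Type _ := F.l2Sections μ

namespace L2Sections

variable {F μ}

instance : AddCommGroup (F.L2Sections μ) := inferInstanceAs (AddCommGroup (F.l2Sections μ))

instance : Module ℝ (F.L2Sections μ) := inferInstanceAs (Module ℝ (F.l2Sections μ))

/-- The value of a section. -/
def val (ω : F.L2Sections μ) (x : M) : TangentSpace 𝓘(ℝ, E) x →L[ℝ] ℝ :=
  (show F.l2Sections μ from ω).1 x

theorem measurable (ω : F.L2Sections μ) : IsMeasurableSection ω.val :=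
  (show F.l2Sections μ from ω).2.1

theorem memLp (ω : F.L2Sections μ) : MemLp (fun x => F.dualNorm x (ω.val x)) 2 μ :=
  (show F.l2Sections μ from ω).2.2

/-- The pointwise norm `x ↦ F^*(x, ω(x))`, as an element of `L²(μ)`. -/
def pnorm (ω : F.L2Sections μ) : Lp ℝ 2 μ := ω.memLp.toLp

theorem coeFn_pnorm (ω : F.L2Sections μ) :
    ω.pnorm =ᵐ[μ] fun x => F.dualNorm x (ω.val x) := ω.memLp.coeFn_toLp

theorem isPointwiseSeminorm : IsPointwiseSeminorm (pnorm : F.L2Sections μ → Lp ℝ 2 μ) := by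
  refine ⟨fun ω => ?_, fun ω η => ?_, fun c ω => ?_⟩
  · rw [← Lp.coeFn_nonneg]
    filter_upwards [ω.coeFn_pnorm] with x h1
    rw [h1]; exact F.dualNorm_nonneg _ _
  · rw [← Lp.coeFn_le]
    filter_upwards [ω.coeFn_pnorm, η.coeFn_pnorm, (ω + η).coeFn_pnorm,
      Lp.coeFn_add ω.pnorm η.pnorm] with x h1 h2 h3 h5
    rw [h5, Pi.add_apply, h1, h2, h3]
    exact F.dualNorm_add_le x _ _
  · refine Lp.ext ?_
    filter_upwards [ω.coeFn_pnorm, (c • ω).coeFn_pnorm, Lp.coeFn_smul |c| ω.pnorm] with x h1 h2 h4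
    rw [h4, h2, Pi.smul_apply, h1]
    exact F.dualNorm_smul x c _

instance : Norm (F.L2Sections μ) := ⟨fun ω => ‖ω.pnorm‖⟩

instance : SeminormedAddCommGroup (F.L2Sections μ) :=
  SeminormedAddCommGroup.ofCore (isPointwiseSeminorm.core (fun _ => rfl))

instance : NormedSpace ℝ (F.L2Sections μ) where
  norm_smul_le c ω := ((isPointwiseSeminorm.core (fun _ => rfl)).norm_smul c ω).le

theorem inseparable_iff (ω η : F.L2Sections μ) :
    Inseparable ω η ↔ ∀ᵐ x ∂μ, ω.val x = η.val x := by
  have h0 : ‖ω - η‖ = ‖(ω - η).pnorm‖ := rfl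
  rw [Metric.inseparable_iff, dist_eq_norm, h0, norm_eq_zero, Lp.eq_zero_iff_ae_eq_zero]
  have hv : ∀ x, (ω - η).val x = ω.val x - η.val x := fun _ => rfl
  constructor
  · intro h
    filter_upwards [h, (ω - η).coeFn_pnorm] with x h1 h2
    rw [h1, Pi.zero_apply] at h2
    rw [← sub_eq_zero, ← hv]
    exact (F.dualNorm_eq_zero_iff x _).1 h2.symm
  · intro h
    filter_upwards [h, (ω - η).coeFn_pnorm] with x h1 h2
    rw [h2, hv, h1, sub_self, Pi.zero_apply]
    exact (F.dualNorm_eq_zero_iff x _).2 rfl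

/-- The product of a bounded function and a section. -/
def mul (a : Linfty μ) (ω : F.L2Sections μ) : F.L2Sections μ :=
  ⟨fun x => (a : M →ₘ[μ] ℝ) x • ω.val x,
    fun x₀ v => ((AEEqFun.stronglyMeasurable (a : M →ₘ[μ] ℝ)).measurable).mul (ω.measurable x₀ v),
    by
      have : (fun x => F.dualNorm x ((a : M →ₘ[μ] ℝ) x • ω.val x)) =
          (fun x => |(a : M →ₘ[μ] ℝ) x|) * fun x => F.dualNorm x (ω.val x) :=
        funext fun x => F.dualNorm_smul x _ _
      rw [this]
      exact ω.memLp.mul (Linfty.memLp a).abs⟩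

theorem val_mul (a : Linfty μ) (ω : F.L2Sections μ) (x : M) :
    (mul a ω).val x = (a : M →ₘ[μ] ℝ) x • ω.val x := rfl

end L2Sections

/-- The concrete cotangent module `Γ₂(T^*M; μ)`: the space of `L²(μ)`-sections of `T^*M`, two
sections being identified if they agree `μ`-a.e. (see `L2Sections.inseparable_iff`). -/
abbrev Gamma2 : Type _ := SeparationQuotient (F.L2Sections μ)

namespace Gamma2

variable {F μ}

theorem mk_eq_mk {ω η : F.L2Sections μ} :
    (SeparationQuotient.mk ω : F.Gamma2 μ) = SeparationQuotient.mk η ↔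
      ∀ᵐ x ∂μ, ω.val x = η.val x :=
  SeparationQuotient.mk_eq_mk.trans (L2Sections.inseparable_iff ω η)

/-- Multiplication by `L^∞(μ)`-functions, defined pointwise. -/
instance : SMul (Linfty μ) (F.Gamma2 μ) :=
  ⟨fun a => SeparationQuotient.lift (fun ω => SeparationQuotient.mk (L2Sections.mul a ω))
    fun ω η h => by
      rw [mk_eq_mk]
      filter_upwards [(L2Sections.inseparable_iff ω η).1 h] with x hx
      rw [L2Sections.val_mul, L2Sections.val_mul, hx]⟩

theorem smul_mk (a : Linfty μ) (ω : F.L2Sections μ) :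
    a • (SeparationQuotient.mk ω : F.Gamma2 μ) = SeparationQuotient.mk (L2Sections.mul a ω) := rfl

instance : Module (Linfty μ) (F.Gamma2 μ) where
  one_smul v := by
    obtain ⟨ω, rfl⟩ := SeparationQuotient.surjective_mk v
    rw [smul_mk, mk_eq_mk]
    filter_upwards [AEEqFun.coeFn_one (β := ℝ) (μ := μ)] with x hx
    have : (((1 : Linfty μ) : M →ₘ[μ] ℝ) : M → ℝ) x = 1 := hx
    rw [L2Sections.val_mul, this, one_smul]
  mul_smul a b v := by
    obtain ⟨ω, rfl⟩ := SeparationQuotient.surjective_mk v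
    rw [smul_mk, smul_mk, smul_mk, mk_eq_mk]
    filter_upwards [AEEqFun.coeFn_mul (a : M →ₘ[μ] ℝ) (b : M →ₘ[μ] ℝ)] with x hx
    have : (((a * b : Linfty μ) : M →ₘ[μ] ℝ) : M → ℝ) x
        = (a : M →ₘ[μ] ℝ) x * (b : M →ₘ[μ] ℝ) x := hx
    rw [L2Sections.val_mul, L2Sections.val_mul, L2Sections.val_mul, this, mul_smul]
  smul_zero a := by
    change a • (SeparationQuotient.mk (0 : F.L2Sections μ) : F.Gamma2 μ) = SeparationQuotient.mk 0
    rw [smul_mk, mk_eq_mk]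
    exact ae_of_all _ fun x => smul_zero _
  smul_add a v w := by
    obtain ⟨ω, rfl⟩ := SeparationQuotient.surjective_mk v
    obtain ⟨η, rfl⟩ := SeparationQuotient.surjective_mk w
    rw [← SeparationQuotient.mk_add, smul_mk, smul_mk, smul_mk, ← SeparationQuotient.mk_add,
      mk_eq_mk]
    exact ae_of_all _ fun x => smul_add _ (ω.val x) (η.val x)
  add_smul a b v := by
    obtain ⟨ω, rfl⟩ := SeparationQuotient.surjective_mk v
    rw [smul_mk, smul_mk, smul_mk, ← SeparationQuotient.mk_add, mk_eq_mk]
    filter_upwards [AEEqFun.coeFn_add (a : M →ₘ[μ] ℝ) (b : M →ₘ[μ] ℝ)] with x hx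
    have : (((a + b : Linfty μ) : M →ₘ[μ] ℝ) : M → ℝ) x
        = (a : M →ₘ[μ] ℝ) x + (b : M →ₘ[μ] ℝ) x := hx
    change _ = (L2Sections.mul a ω).val x + (L2Sections.mul b ω).val x
    rw [L2Sections.val_mul, L2Sections.val_mul, L2Sections.val_mul, this, add_smul]
  zero_smul v := by
    obtain ⟨ω, rfl⟩ := SeparationQuotient.surjective_mk v
    rw [smul_mk, ← SeparationQuotient.mk_zero, mk_eq_mk]
    filter_upwards [AEEqFun.coeFn_zero (β := ℝ) (μ := μ)] with x hx
    have : (((0 : Linfty μ) : M →ₘ[μ] ℝ) : M → ℝ) x = 0 := hx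
    rw [L2Sections.val_mul, this, zero_smul]
    rfl

instance : IsScalarTower ℝ (Linfty μ) (F.Gamma2 μ) where
  smul_assoc c a v := by
    obtain ⟨ω, rfl⟩ := SeparationQuotient.surjective_mk v
    rw [smul_mk, smul_mk, ← SeparationQuotient.mk_smul, mk_eq_mk]
    filter_upwards [AEEqFun.coeFn_smul c (a : M →ₘ[μ] ℝ)] with x hx
    have : (((c • a : Linfty μ) : M →ₘ[μ] ℝ) : M → ℝ) x = c * (a : M →ₘ[μ] ℝ) x := hx
    change _ = c • (L2Sections.mul a ω).val x
    rw [L2Sections.val_mul, L2Sections.val_mul, this, mul_smul]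

/-- The pointwise norm `x ↦ F^*(x, ω(x))`. -/
instance : L2NormedModule μ (F.Gamma2 μ) where
  pnorm := SeparationQuotient.lift L2Sections.pnorm fun ω η h => by
    refine Lp.ext ?_
    filter_upwards [(L2Sections.inseparable_iff ω η).1 h, ω.coeFn_pnorm, η.coeFn_pnorm]
      with x h1 h2 h3
    rw [h2, h3, h1]
  pnorm_nonneg v := by
    obtain ⟨ω, rfl⟩ := SeparationQuotient.surjective_mk v
    exact L2Sections.isPointwiseSeminorm.nonneg ω
  norm_pnorm v := by
    obtain ⟨ω, rfl⟩ := SeparationQuotient.surjective_mk v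
    rw [SeparationQuotient.norm_mk]; rfl
  pnorm_smul a v := by
    obtain ⟨ω, rfl⟩ := SeparationQuotient.surjective_mk v
    rw [smul_mk, SeparationQuotient.lift_mk, SeparationQuotient.lift_mk]
    filter_upwards [(L2Sections.mul a ω).coeFn_pnorm, ω.coeFn_pnorm] with x h1 h2
    rw [h1, h2, L2Sections.val_mul]
    exact F.dualNorm_smul x _ _

end Gamma2

end FinslerStructure

namespace C1c

theorem continuousOn_diff {f : M → ℝ} (hf : ContMDiff 𝓘(ℝ, E) 𝓘(ℝ) 1 f) (x₀ : M) :
    ContinuousOn (fun z : M × E =>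
      diff E f z.1 ((trivializationAt E (TangentSpace 𝓘(ℝ, E)) x₀).symmL ℝ z.1 z.2))
      ((trivializationAt E (TangentSpace 𝓘(ℝ, E)) x₀).baseSet ×ˢ univ) :=
  ((continuous_snd.comp (tangentBundleModelSpaceHomeomorph 𝓘(ℝ, ℝ)).continuous).comp
    (hf.continuous_tangentMap le_rfl)).comp_continuousOn
      (FinslerStructure.continuousOn_symmL x₀)

theorem isMeasurableSection_diff {f : M → ℝ} (hf : ContMDiff 𝓘(ℝ, E) 𝓘(ℝ) 1 f) :
    IsMeasurableSection (diff E f) := by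
  intro x₀ v
  classical
  set U := (trivializationAt E (TangentSpace 𝓘(ℝ, E)) x₀).baseSet with hU
  have hUo : IsOpen U := (trivializationAt E (TangentSpace 𝓘(ℝ, E)) x₀).open_baseSet
  have h1 : ContinuousOn (fun x =>
      diff E f x ((trivializationAt E (TangentSpace 𝓘(ℝ, E)) x₀).symmL ℝ x v)) U :=
    (continuousOn_diff hf x₀).comp (f := fun x => (x, v)) (by fun_prop) fun x hx => ⟨hx, trivial⟩
  have h2 : (fun x => diff E f x ((trivializationAt E (TangentSpace 𝓘(ℝ, E)) x₀).symmL ℝ x v)) =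
      U.piecewise (fun x =>
        diff E f x ((trivializationAt E (TangentSpace 𝓘(ℝ, E)) x₀).symmL ℝ x v)) fun _ => 0 := by
    funext x
    by_cases hx : x ∈ U
    · rw [piecewise_eq_of_mem _ _ _ hx]
    · rw [piecewise_eq_of_notMem _ _ _ hx,
        Bundle.Trivialization.symmL_apply_of_notMem _ hx, map_zero]
  rw [h2]
  exact h1.measurable_piecewise continuousOn_const hUo.measurableSet

theorem eventually_dualNorm_le (F : FinslerStructure E M) {f : M → ℝ}
    (hf : ContMDiff 𝓘(ℝ, E) 𝓘(ℝ) 1 f) (x₀ : M) :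
    ∃ C, ∀ᶠ x in 𝓝 x₀, F.dualNorm x (diff E f x) ≤ C := by
  set e := trivializationAt E (TangentSpace 𝓘(ℝ, E)) x₀ with he
  obtain ⟨C, hC0, hC⟩ := F.exists_le x₀ (diff E f x₀)
  have hx₀ : x₀ ∈ e.baseSet := FiberBundle.mem_baseSet_trivializationAt' x₀
  have hnb : ∀ v : E, e.baseSet ×ˢ (univ : Set E) ∈ 𝓝 (x₀, v) := fun v =>
    prod_mem_nhds (e.open_baseSet.mem_nhds hx₀) univ_mem
  have hinj : ∀ v : E, e.symmL ℝ x₀ v = 0 → v = 0 := fun v hv => by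
    rw [← e.continuousLinearMapAt_symmL (R := ℝ) hx₀ v, hv, map_zero]
  have h1 : ∀ v ∈ Metric.sphere (0 : E) 1, ∀ᶠ z : M × E in 𝓝 (x₀, v),
      |diff E f z.1 (e.symmL ℝ z.1 z.2)| < (C + 1) * F z.1 (e.symmL ℝ z.1 z.2) := by
    intro v hv
    have c1 : ContinuousAt (fun z : M × E => |diff E f z.1 (e.symmL ℝ z.1 z.2)|) (x₀, v) :=
      ((continuousOn_diff hf x₀).continuousAt (hnb v)).abs
    have c2 : ContinuousAt (fun z : M × E => (C + 1) * F z.1 (e.symmL ℝ z.1 z.2)) (x₀, v) :=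
      ((F.continuous_toFun.comp_continuousOn
        (FinslerStructure.continuousOn_symmL x₀)).continuousAt (hnb v)).const_mul (C + 1)
    refine c1.eventually_lt c2 ?_
    have hv0 : e.symmL ℝ x₀ v ≠ 0 := fun h => by
      rw [hinj v h] at hv; simp at hv
    have := hC (e.symmL ℝ x₀ v)
    have hp := F.pos hv0
    change |diff E f x₀ (e.symmL ℝ x₀ v)| < (C + 1) * F x₀ (e.symmL ℝ x₀ v)
    linarith
  have h2 := (isCompact_sphere (0 : E) 1).eventually_forall_of_forall_eventually (x₀ := x₀)
    (P := fun x v => |diff E f x (e.symmL ℝ x v)| < (C + 1) * F x (e.symmL ℝ x v)) h1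
  refine ⟨C + 1, ?_⟩
  filter_upwards [h2, e.open_baseSet.mem_nhds hx₀] with x hx hxU
  refine F.dualNorm_le (by positivity) fun w => ?_
  obtain ⟨v, rfl⟩ : ∃ v, e.symmL ℝ x v = w := ⟨_, e.symmL_continuousLinearMapAt (R := ℝ) hxU w⟩
  rcases eq_or_ne v 0 with rfl | hv
  · rw [map_zero, map_zero, abs_zero]
    exact mul_nonneg (by positivity) (F.nonneg x _)
  · have hn : 0 < ‖v‖ := norm_pos_iff.2 hv
    have hu : ‖v‖⁻¹ • v ∈ Metric.sphere (0 : E) 1 := by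
      rw [mem_sphere_zero_iff_norm, norm_smul, norm_inv, norm_norm, inv_mul_cancel₀ hn.ne']
    have h3 := (hx _ hu).le
    have h4 : F x (‖v‖⁻¹ • e.symmL ℝ x v) = ‖v‖⁻¹ * F x (e.symmL ℝ x v) :=
      (F.isMinkowskiNorm x).homogeneous _ _ (inv_pos.2 hn).le
    rw [map_smul, map_smul, h4, smul_eq_mul, abs_mul, abs_of_pos (inv_pos.2 hn),
      mul_left_comm] at h3
    exact le_of_mul_le_mul_left h3 (inv_pos.2 hn)

theorem memLp_dualNorm_diff (F : FinslerStructure E M) (μ : Measure M)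
    [IsFiniteMeasureOnCompacts μ] (f : C1c E M) :
    MemLp (fun x => F.dualNorm x (diff E f.toFun x)) 2 μ := by
  have hK : IsCompact (tsupport f.toFun) := f.hasCompactSupport
  have hbd : ∃ C, 0 ≤ C ∧ ∀ x ∈ tsupport f.toFun, F.dualNorm x (diff E f.toFun x) ≤ C := by
    choose C hC using fun x => eventually_dualNorm_le F f.contMDiff x
    obtain ⟨t, -, ht⟩ := hK.elim_nhds_subcover (fun x =>
      {y | F.dualNorm y (diff E f.toFun y) ≤ C x}) fun x _ => hC x
    refine ⟨∑ x ∈ t, |C x|, Finset.sum_nonneg fun _ _ => abs_nonneg _, fun y hy => ?_⟩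
    obtain ⟨x, hx, hyx⟩ := mem_iUnion₂.1 (ht hy)
    exact (show F.dualNorm y (diff E f.toFun y) ≤ C x from hyx).trans ((le_abs_self _).trans
      (Finset.single_le_sum (f := fun x => |C x|) (fun _ _ => abs_nonneg _) hx))
  obtain ⟨C, hC0, hC⟩ := hbd
  have hzero : ∀ x ∉ tsupport f.toFun, diff E f.toFun x = 0 := by
    intro x hx
    have h1 : f.toFun =ᶠ[𝓝 x] fun _ => 0 := notMem_tsupport_iff_eventuallyEq.1 hx
    rw [diff, h1.mfderiv_eq, mfderiv_const]
    rfl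
  have hms : MeasurableSet (tsupport f.toFun) := (isClosed_tsupport _).measurableSet
  refine MemLp.mono (g := (tsupport f.toFun).indicator fun _ => C)
    (memLp_indicator_const 2 hms C (Or.inr hK.measure_lt_top.ne))
    (F.measurable_dualNorm (isMeasurableSection_diff f.contMDiff)).aestronglyMeasurable
    (ae_of_all _ fun x => ?_)
  rw [Real.norm_of_nonneg (F.dualNorm_nonneg _ _)]
  by_cases hx : x ∈ tsupport f.toFun
  · rw [indicator_of_mem hx]; exact (hC x hx).trans (le_abs_self C)
  · rw [hzero x hx, (F.dualNorm_eq_zero_iff x _).2 rfl]; exact norm_nonneg _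

/-- The differential `\underline{d}f` of `f ∈ C¹_c(M)` as an element of `Γ₂(T^*M; μ)`. -/
def concreteDiff (F : FinslerStructure E M) (μ : Measure M) [IsFiniteMeasureOnCompacts μ]
    (f : C1c E M) : F.Gamma2 μ :=
  SeparationQuotient.mk (show F.L2Sections μ from
    ⟨diff E f.toFun, isMeasurableSection_diff f.contMDiff, memLp_dualNorm_diff F μ f⟩)

/-- The a.e. class of `f ∈ C¹_c(M)`. -/
def toL2 (μ : Measure M) [IsFiniteMeasureOnCompacts μ] (f : C1c E M) : Lp ℝ 2 μ :=
  (f.contMDiff.continuous.memLp_of_hasCompactSupport f.hasCompactSupport).toLp f.toFun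

end C1c

end Finsler

end FinslerModules

end

open FinslerModules MeasureTheory
open scoped Manifold

open MeasureTheory Filter Topology Set
open scoped ENNReal NNReal Manifold

noncomputable section

namespace FinslerModules

section

variable {E : Type*} [NormedAddCommGroup E] [NormedSpace ℝ E]
  {M : Type*} [TopologicalSpace M] [ChartedSpace E M]

/-! ### Locality and linearity of the differential. -/

namespace C1c

/-! All of the analysis sits in one inequality, `|df| ≤ |\underline df|` for `f ∈ C¹_c(M)`
(`C1c.pnorm_differential_le`); it holds because `x ↦ F^*(x, df(x))` is a weak upper gradient of `f`.
To see this, let `C > F^*(x, df(x))`. The dual norm of `df` stays below `C` near `x`, so integrating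
`df` along a curve that remains near `x` bounds the increment of `f` by `C` times the length. A
curve that leaves the neighbourhood has length bounded below, which is detected by integrating the
differential of a bump function, and so it is no shortcut between points very close to `x`. Hence
`f` is `C`-Lipschitz near `x` for the Finsler distance (`C1c.exists_abs_sub_le_mul_dist`). Along an
absolutely continuous curve, `f ∘ γ` is then absolutely continuous, with derivative bounded a.e. by
`F^*(γ, df)` times the metric speed; integrating gives the inequality curve by curve, before any
test plan is involved.

The rest is algebra of `L²`-normed modules. A combination of differentials with constant
coefficients is the differential of one function, so `|∑ c_i df_i| ≤ |∑ c_i \underline df_i|` for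
real `c_i`. Using rational constants and a common null set, the same pointwise estimate follows for
coefficients in `L^∞(μ)` (`L2NormedModule.pnorm_sum_smul_le`). Therefore `∑ a_i \underline df_i ↦ ∑
a_i df_i` is well defined and does not increase pointwise norms.

Finally, the forms `∑ a_i \underline df_i` are dense in `Γ₂(T^*M; μ)`
(`FinslerStructure.dense_span_concreteDiff`): cut-off coordinates provide local frames of
differentials, and a section can be cut off to finitely many frame domains and to the sets where its
coefficients are bounded. Since the cotangent module is complete, the map extends by continuity;
density also gives uniqueness, and the pointwise bound is a closed condition
(`L2NormedModule.exists_extension`). -/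

theorem diff_eq_zero_of_notMem_tsupport {f : M → ℝ} {x : M} (hx : x ∉ tsupport f) :
    diff E f x = 0 := by
  have h1 : f =ᶠ[𝓝 x] fun _ => 0 := notMem_tsupport_iff_eventuallyEq.1 hx
  rw [diff, h1.mfderiv_eq, mfderiv_const]
  rfl

theorem diff_add {f g : M → ℝ} (hf : ContMDiff 𝓘(ℝ, E) 𝓘(ℝ) 1 f)
    (hg : ContMDiff 𝓘(ℝ, E) 𝓘(ℝ) 1 g) (x : M) : diff E (f + g) x = diff E f x + diff E g x := by
  have hf' : MDifferentiableAt 𝓘(ℝ, E) 𝓘(ℝ) f x := hf.mdifferentiableAt one_ne_zero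
  have hg' : MDifferentiableAt 𝓘(ℝ, E) 𝓘(ℝ) g x := hg.mdifferentiableAt one_ne_zero
  ext v
  exact congrArg (fun L : E →L[ℝ] ℝ => L v) (mfderiv_add hf' hg')

theorem diff_smul (c : ℝ) {f : M → ℝ} (hf : ContMDiff 𝓘(ℝ, E) 𝓘(ℝ) 1 f) (x : M) :
    diff E (c • f) x = c • diff E f x := by
  have hf' : MDifferentiableAt 𝓘(ℝ, E) 𝓘(ℝ) f x := hf.mdifferentiableAt one_ne_zero
  ext v
  exact congrArg (fun L : E →L[ℝ] ℝ => L v) (const_smul_mfderiv hf' c)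

end C1c

variable [IsManifold 𝓘(ℝ, E) ((⊤ : ℕ∞) : WithTop ℕ∞) M]

/-! ### Increments of functions along piecewise `C¹` curves. -/

/-- The one-sided comparison inequality, applied to `g` and to `-g`. It needs integrability of the
majorant only, and says nothing about `g'` at the endpoints. -/
theorem abs_sub_le_integral_of_hasDerivAt {g g' φ : ℝ → ℝ} {a b : ℝ} (hab : a ≤ b)
    (hg : ContinuousOn g (Icc a b)) (hd : ∀ t ∈ Ioo a b, HasDerivAt g (g' t) t)
    (hφ : IntervalIntegrable φ volume a b) (h : ∀ t ∈ Ioo a b, |g' t| ≤ φ t) :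
    |g b - g a| ≤ ∫ t in a..b, φ t := by
  have hφ' : IntegrableOn φ (Icc a b) := (intervalIntegrable_iff_integrableOn_Icc_of_le hab).1 hφ
  rw [abs_le']
  constructor
  · exact intervalIntegral.sub_le_integral_of_hasDeriv_right_of_le hab hg
      (fun t ht => (hd t ht).hasDerivWithinAt) hφ' fun t ht => (le_abs_self _).trans (h t ht)
  · have := intervalIntegral.sub_le_integral_of_hasDeriv_right_of_le (g := fun t => -g t) hab hg.neg
      (fun t ht => (hd t ht).neg.hasDerivWithinAt) hφ' fun t ht => (neg_le_abs _).trans (h t ht)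
    linarith

namespace FinslerStructure

/-- The speed `F(γ_t, γ'_t)` of a curve. -/
def speed (F : FinslerStructure E M) (γ : ℝ → M) (t : ℝ) : ℝ :=
  F (γ t) (mfderiv 𝓘(ℝ) 𝓘(ℝ, E) γ t (1 : ℝ))

variable (F : FinslerStructure E M)

theorem speed_nonneg (γ : ℝ → M) (t : ℝ) : 0 ≤ F.speed γ t := F.nonneg _ _

theorem length_nonneg (γ : ℝ → M) : 0 ≤ F.length γ :=
  intervalIntegral.integral_nonneg zero_le_one fun t _ => F.speed_nonneg γ t

/-- At the ends of a piece `mfderiv` may take its default value, so `speed` need not be continuous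
there. In the interior it agrees with the speed computed from `mfderivWithin`, which is continuous
on the closed interval. -/
theorem intervalIntegrable_speed_of_contMDiffOn {γ : ℝ → M} {a b : ℝ} (hab : a ≤ b)
    (hγ : ContMDiffOn 𝓘(ℝ) 𝓘(ℝ, E) 1 γ (Icc a b)) :
    IntervalIntegrable (F.speed γ) volume a b := by
  -- Partitions are only weakly monotone, so a piece may be a point, where derivatives within the
  -- piece are not unique.
  rcases hab.eq_or_lt with rfl | hlt
  · exact IntervalIntegrable.refl
  have hu : UniqueMDiffOn 𝓘(ℝ) (Icc a b) := (uniqueDiffOn_Icc hlt).uniqueMDiffOn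
  have h1 : ContinuousOn (fun t : ℝ => tangentMapWithin 𝓘(ℝ) 𝓘(ℝ, E) γ (Icc a b)
      (⟨t, (1 : ℝ)⟩ : TangentBundle 𝓘(ℝ) ℝ)) (Icc a b) := by
    refine (hγ.continuousOn_tangentMapWithin le_rfl hu).comp (f := fun t : ℝ =>
      (⟨t, (1 : ℝ)⟩ : TangentBundle 𝓘(ℝ) ℝ)) ?_ fun t ht => ht
    exact ((tangentBundleModelSpaceHomeomorph 𝓘(ℝ, ℝ)).symm.continuous.comp
      (f := fun t : ℝ => (t, (1 : ℝ))) (by fun_prop)).continuousOn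
  have h2 : ContinuousOn (fun t : ℝ => F (γ t) (mfderivWithin 𝓘(ℝ) 𝓘(ℝ, E) γ (Icc a b) t (1 : ℝ)))
      (Icc a b) := F.continuous_toFun.comp_continuousOn h1
  have h3 := h2.intervalIntegrable_of_Icc (μ := volume) hab
  refine h3.congr_uIoo fun t ht => ?_
  rw [uIoo_of_le hab] at ht
  exact congrArg (fun L : ℝ →L[ℝ] E => F (γ t) (L 1))
    (mfderivWithin_of_mem_nhds (Icc_mem_nhds ht.1 ht.2))

/-- By the chain rule `(f ∘ γ)' = df(γ')`, and `|df(γ')| ≤ F^*(γ, df) F(γ, γ')`. -/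
theorem abs_sub_le_integral_speed_of_contMDiffOn [FiniteDimensional ℝ E]
    {f : M → ℝ} (hf : ContMDiff 𝓘(ℝ, E) 𝓘(ℝ) 1 f)
    {γ : ℝ → M} {a b C : ℝ} (hab : a ≤ b) (hγ : ContMDiffOn 𝓘(ℝ) 𝓘(ℝ, E) 1 γ (Icc a b))
    (hC : ∀ t ∈ Icc a b, F.dualNorm (γ t) (diff E f (γ t)) ≤ C) :
    |f (γ b) - f (γ a)| ≤ C * ∫ t in a..b, F.speed γ t := by
  rw [← intervalIntegral.integral_const_mul]
  refine abs_sub_le_integral_of_hasDerivAt (g := f ∘ γ)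
    (g' := fun t => diff E f (γ t) (mfderiv 𝓘(ℝ) 𝓘(ℝ, E) γ t (1 : ℝ))) hab
    (hf.continuous.comp_continuousOn hγ.continuousOn) (fun t ht => ?_)
    ((F.intervalIntegrable_speed_of_contMDiffOn hab hγ).const_mul C) fun t ht => ?_
  · let A : E →L[ℝ] ℝ := diff E f (γ t)
    let B : ℝ →L[ℝ] E := mfderiv 𝓘(ℝ) 𝓘(ℝ, E) γ t
    have h1 : MDifferentiableAt 𝓘(ℝ) 𝓘(ℝ, E) γ t :=
      ((hγ t (Ioo_subset_Icc_self ht)).contMDiffAt (Icc_mem_nhds ht.1 ht.2)).mdifferentiableAt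
        one_ne_zero
    have h2 : MDifferentiableAt 𝓘(ℝ, E) 𝓘(ℝ) f (γ t) := hf.mdifferentiableAt one_ne_zero
    have h3 : HasFDerivAt (f ∘ γ) (A.comp B) t :=
      (h2.hasMFDerivAt.comp t h1.hasMFDerivAt).hasFDerivAt
    exact h3.hasDerivAt
  · exact (F.abs_le_dualNorm_mul _ _ _).trans
      (mul_le_mul_of_nonneg_right (hC t (Ioo_subset_Icc_self ht)) (F.nonneg _ _))

/-- Induction over the pieces. Integrability is carried along because the integral of a
non-integrable speed would be `0` by convention. The endpoint `u` is arbitrary so that a curve can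
be stopped at the moment it is outside a given set. -/
theorem integral_speed_initial [FiniteDimensional ℝ E] {γ : ℝ → M} {k : ℕ} {t : ℕ → ℝ}
    (htm : Monotone t) (ht0 : t 0 = 0)
    (hγ : ∀ i < k, ContMDiffOn 𝓘(ℝ) 𝓘(ℝ, E) 1 γ (Icc (t i) (t (i + 1)))) {i : ℕ} (hi : i ≤ k) :
    ∀ u ∈ Icc 0 (t i), IntervalIntegrable (F.speed γ) volume 0 u ∧
      ∀ {f : M → ℝ} {C : ℝ}, ContMDiff 𝓘(ℝ, E) 𝓘(ℝ) 1 f →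
        (∀ s ∈ Icc 0 u, F.dualNorm (γ s) (diff E f (γ s)) ≤ C) →
        |f (γ u) - f (γ 0)| ≤ C * ∫ s in (0 : ℝ)..u, F.speed γ s := by
  induction i with
  | zero =>
    intro u hu
    obtain rfl : u = 0 := by rw [ht0] at hu; exact le_antisymm hu.2 hu.1
    refine ⟨IntervalIntegrable.refl, fun _ _ => by simp⟩
  | succ i ih =>
    intro u hu
    rcases le_total u (t i) with hui | hui
    · exact ih (by omega) u ⟨hu.1, hui⟩
    have hti : 0 ≤ t i := ht0 ▸ htm (Nat.zero_le i)
    obtain ⟨h1, h2⟩ := ih (by omega) (t i) ⟨hti, le_rfl⟩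
    -- The last piece is cut at `u`.
    have h3 := (hγ i (by omega)).mono (Icc_subset_Icc_right hu.2)
    have h4 := F.intervalIntegrable_speed_of_contMDiffOn hui h3
    refine ⟨h1.trans h4, fun {f C} hf hC => ?_⟩
    have h5 := h2 hf fun s hs => hC s ⟨hs.1, hs.2.trans hui⟩
    have h6 := F.abs_sub_le_integral_speed_of_contMDiffOn hf hui h3 (C := C) fun s hs =>
      hC s ⟨hti.trans hs.1, hs.2⟩
    rw [← intervalIntegral.integral_add_adjacent_intervals h1 h4, mul_add]
    have h7 := abs_add_le (f (γ u) - f (γ (t i))) (f (γ (t i)) - f (γ 0))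
    rw [sub_add_sub_cancel] at h7
    linarith

theorem abs_sub_le_mul_length [FiniteDimensional ℝ E] {γ : ℝ → M} (hγ : IsPiecewiseC1 E γ)
    {f : M → ℝ} (hf : ContMDiff 𝓘(ℝ, E) 𝓘(ℝ) 1 f) {C : ℝ} (hC0 : 0 ≤ C) {u : ℝ}
    (hu : u ∈ Icc (0 : ℝ) 1) (hC : ∀ s ∈ Icc 0 u, F.dualNorm (γ s) (diff E f (γ s)) ≤ C) :
    |f (γ u) - f (γ 0)| ≤ C * F.length γ := by
  obtain ⟨-, k, t, htm, ht0, htk, hd⟩ := hγ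
  have h1 := F.integral_speed_initial htm ht0 hd le_rfl
  rw [htk] at h1
  refine ((h1 u hu).2 hf hC).trans (mul_le_mul_of_nonneg_left ?_ hC0)
  exact intervalIntegral.integral_mono_interval le_rfl hu.1 hu.2
    (ae_of_all _ fun s => F.speed_nonneg γ s) (h1 1 ⟨zero_le_one, le_rfl⟩).1

end FinslerStructure

/-- Segments in a chart. This is needed because the Finsler distance is an infimum of real numbers,
which is `0` over the empty set: a lower bound for it requires a competitor. -/
theorem eventually_exists_isPiecewiseC1 (x : M) :
    ∃ V ∈ 𝓝 x, ∀ y ∈ V, ∀ z ∈ V, ∃ γ : ℝ → M, IsPiecewiseC1 E γ ∧ γ 0 = y ∧ γ 1 = z := by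
  set e := extChartAt 𝓘(ℝ, E) x
  obtain ⟨r, hr, hrt⟩ := Metric.isOpen_iff.1 (isOpen_extChartAt_target (I := 𝓘(ℝ, E)) x) (e x)
    (mem_extChartAt_target x)
  refine ⟨e.source ∩ e ⁻¹' Metric.ball (e x) r, inter_mem (extChartAt_source_mem_nhds x)
    ((continuousAt_extChartAt x).preimage_mem_nhds (Metric.ball_mem_nhds _ hr)), ?_⟩
  rintro y ⟨hy, hyr⟩ z ⟨hz, hzr⟩
  have hd : ContMDiffOn 𝓘(ℝ) 𝓘(ℝ, E) 1 (fun t : ℝ => e.symm (AffineMap.lineMap (e y) (e z) t))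
      (Icc 0 1) := by
    refine (contMDiffOn_extChartAt_symm (n := 1) x).comp (t := e.target)
      (f := fun t : ℝ => AffineMap.lineMap (e y) (e z) t) ?_ fun t ht =>
        hrt ((convex_ball (e x) r).lineMap_mem hyr hzr ht)
    refine ContDiff.contMDiff (n := 1) ?_ |>.contMDiffOn
    simp only [AffineMap.lineMap_apply_module]
    fun_prop
  refine ⟨_, ⟨hd.continuousOn, 1, fun i => (i : ℝ), Nat.mono_cast, by simp, by simp, ?_⟩, ?_, ?_⟩
  · intro i hi
    obtain rfl : i = 0 := by omega
    simpa using hd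
  · simpa using e.left_inv hy
  · simpa using e.left_inv hz

/-! ### `C¹` functions are locally Lipschitz for the Finsler distance. -/

namespace C1c

variable [FiniteDimensional ℝ E] [MeasurableSpace M] [BorelSpace M] [SecondCountableTopology M]

/-- Upper semicontinuity of the dual norm of the differential of a `C¹` function. -/
theorem eventually_dualNorm_diff_le (F : FinslerStructure E M) {f : M → ℝ}
    (hf : ContMDiff 𝓘(ℝ, E) 𝓘(ℝ) 1 f) (x₀ : M) {C : ℝ} (hC : F.dualNorm x₀ (diff E f x₀) < C) :
    ∀ᶠ x in 𝓝 x₀, F.dualNorm x (diff E f x) ≤ C := by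
  set e := trivializationAt E (TangentSpace 𝓘(ℝ, E)) x₀ with he
  have hC0 : 0 < C := (F.dualNorm_nonneg _ _).trans_lt hC
  have hx₀ : x₀ ∈ e.baseSet := FiberBundle.mem_baseSet_trivializationAt' x₀
  have hnb : ∀ v : E, e.baseSet ×ˢ (univ : Set E) ∈ 𝓝 (x₀, v) := fun v =>
    prod_mem_nhds (e.open_baseSet.mem_nhds hx₀) univ_mem
  have hinj : ∀ v : E, e.symmL ℝ x₀ v = 0 → v = 0 := fun v hv => by
    rw [← e.continuousLinearMapAt_symmL (R := ℝ) hx₀ v, hv, map_zero]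
  -- In a trivialization the strict inequality is an open condition on (point, vector).
  have h1 : ∀ v ∈ Metric.sphere (0 : E) 1, ∀ᶠ z : M × E in 𝓝 (x₀, v),
      |diff E f z.1 (e.symmL ℝ z.1 z.2)| < C * F z.1 (e.symmL ℝ z.1 z.2) := by
    intro v hv
    have c1 : ContinuousAt (fun z : M × E => |diff E f z.1 (e.symmL ℝ z.1 z.2)|) (x₀, v) :=
      ((continuousOn_diff hf x₀).continuousAt (hnb v)).abs
    have c2 : ContinuousAt (fun z : M × E => C * F z.1 (e.symmL ℝ z.1 z.2)) (x₀, v) :=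
      ((F.continuous_toFun.comp_continuousOn
        (FinslerStructure.continuousOn_symmL x₀)).continuousAt (hnb v)).const_mul C
    refine c1.eventually_lt c2 ?_
    have hv0 : e.symmL ℝ x₀ v ≠ 0 := fun h => by
      rw [hinj v h] at hv; simp at hv
    exact (F.abs_le_dualNorm_mul x₀ (diff E f x₀) (e.symmL ℝ x₀ v)).trans_lt
      (mul_lt_mul_of_pos_right hC (F.pos hv0))
  -- Compactness of the sphere gives one neighbourhood of `x₀` that serves all directions;
  -- homogeneity then covers all vectors.
  have h2 := (isCompact_sphere (0 : E) 1).eventually_forall_of_forall_eventually (x₀ := x₀)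
    (P := fun x v => |diff E f x (e.symmL ℝ x v)| < C * F x (e.symmL ℝ x v)) h1
  filter_upwards [h2, e.open_baseSet.mem_nhds hx₀] with x hx hxU
  refine F.dualNorm_le hC0.le fun w => ?_
  obtain ⟨v, rfl⟩ : ∃ v, e.symmL ℝ x v = w := ⟨_, e.symmL_continuousLinearMapAt (R := ℝ) hxU w⟩
  rcases eq_or_ne v 0 with rfl | hv
  · rw [map_zero, map_zero, abs_zero]
    exact mul_nonneg hC0.le (F.nonneg x _)
  · have hn : 0 < ‖v‖ := norm_pos_iff.2 hv
    have hu : ‖v‖⁻¹ • v ∈ Metric.sphere (0 : E) 1 := by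
      rw [mem_sphere_zero_iff_norm, norm_smul, norm_inv, norm_norm, inv_mul_cancel₀ hn.ne']
    have h3 := (hx _ hu).le
    have h4 : F x (‖v‖⁻¹ • e.symmL ℝ x v) = ‖v‖⁻¹ * F x (e.symmL ℝ x v) :=
      (F.isMinkowskiNorm x).homogeneous _ _ (inv_pos.2 hn).le
    rw [map_smul, map_smul, h4, smul_eq_mul, abs_mul, abs_of_pos (inv_pos.2 hn),
      mul_left_comm] at h3
    exact le_of_mul_le_mul_left h3 (inv_pos.2 hn)

/-- Finitely many local bounds cover the compact support, and the differential vanishes off it. The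
sum of the local bounds stands in for their maximum. -/
theorem exists_dualNorm_diff_le (F : FinslerStructure E M) (f : C1c E M) :
    ∃ C, 0 ≤ C ∧ ∀ x, F.dualNorm x (diff E f.toFun x) ≤ C := by
  have hK : IsCompact (tsupport f.toFun) := f.hasCompactSupport
  obtain ⟨t, -, ht⟩ := hK.elim_nhds_subcover (fun x =>
      {y | F.dualNorm y (diff E f.toFun y) ≤ F.dualNorm x (diff E f.toFun x) + 1}) fun x _ =>
    eventually_dualNorm_diff_le F f.contMDiff x (lt_add_one _)
  have h0 : ∀ x, 0 ≤ F.dualNorm x (diff E f.toFun x) + 1 := fun x =>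
    add_nonneg (F.dualNorm_nonneg _ _) zero_le_one
  refine ⟨∑ x ∈ t, (F.dualNorm x (diff E f.toFun x) + 1), Finset.sum_nonneg fun x _ => h0 x,
    fun y => ?_⟩
  by_cases hy : y ∈ tsupport f.toFun
  · obtain ⟨x, hx, hyx⟩ := mem_iUnion₂.1 (ht hy)
    exact le_trans hyx (Finset.single_le_sum (f := fun x =>
      F.dualNorm x (diff E f.toFun x) + 1) (fun x _ => h0 x) hx)
  · rw [diff_eq_zero_of_notMem_tsupport hy, (F.dualNorm_eq_zero_iff y _).2 rfl]
    exact Finset.sum_nonneg fun x _ => h0 x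

variable [T2Space M]

/-- A smooth bump function as an element of `C¹_c(M)`. -/
def ofBump {x : M} (ψ : SmoothBumpFunction 𝓘(ℝ, E) x) : C1c E M where
  toFun := ψ
  contMDiff := ψ.contMDiff.of_le (by norm_cast)
  hasCompactSupport := ψ.hasCompactSupport

/-- Near `x`, a `C¹` function is Lipschitz with any constant larger than `F^*(x, df(x))`. -/
theorem exists_abs_sub_le_mul_dist (F : FinslerStructure E M) {f : M → ℝ}
    (hf : ContMDiff 𝓘(ℝ, E) 𝓘(ℝ) 1 f) (x : M) {C : ℝ} (hC : F.dualNorm x (diff E f x) < C) :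
    ∃ V ∈ 𝓝 x, ∀ y ∈ V, ∀ z ∈ V, |f z - f y| ≤ C * F.dist y z := by
  have hC0 : 0 < C := (F.dualNorm_nonneg _ _).trans_lt hC
  -- The bump `ψ` lives where `F^*(df) ≤ C`. A curve that starts where `ψ = 1` and meets `ψ = 0` has
  -- length at least `1 / (K + 1)`, where `K` bounds `F^*(dψ)`.
  obtain ⟨ψ, -, hψU⟩ := (SmoothBumpFunction.nhds_basis_support (I := 𝓘(ℝ, E)) (c := x)
    univ_mem).mem_iff.1 (eventually_dualNorm_diff_le F hf x hC)
  obtain ⟨K, hK0, hK⟩ := exists_dualNorm_diff_le F (ofBump ψ)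
  obtain ⟨V₀, hV₀, hseg⟩ := eventually_exists_isPiecewiseC1 (E := E) x
  -- With oscillation below `C / (K + 1)` near `x`, curves leaving the support of `ψ` satisfy the
  -- estimate trivially.
  have hη : 0 < C * (K + 1)⁻¹ / 2 := by positivity
  have hfV := (hf.continuous.tendsto x).eventually (Metric.ball_mem_nhds (f x) hη)
  refine ⟨_, inter_mem hV₀ (inter_mem ψ.eventuallyEq_one hfV), ?_⟩
  rintro y ⟨hy0, hy1, hyf⟩ z ⟨hz0, hz1, hzf⟩
  have hyz : |f z - f y| ≤ C * (K + 1)⁻¹ := by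
    rw [mem_ofPred_eq] at hyf hzf
    rw [← Real.dist_eq]
    linarith [dist_triangle_right (f z) (f y) (f x)]
  have hlen : ∀ γ : ℝ → M, IsPiecewiseC1 E γ → γ 0 = y → γ 1 = z →
      |f z - f y| ≤ C * F.length γ := by
    intro γ hγ h0 h1
    by_cases hU : ∀ s ∈ Icc (0 : ℝ) 1, F.dualNorm (γ s) (diff E f (γ s)) ≤ C
    · have := F.abs_sub_le_mul_length hγ hf hC0.le ⟨zero_le_one, le_rfl⟩ hU
      rwa [h0, h1] at this
    · push Not at hU
      obtain ⟨s, hs, hsC⟩ := hU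
      have hψs : ψ (γ s) = 0 := by
        by_contra h
        exact absurd (hψU (Function.mem_support.2 h)) (not_le.2 hsC)
      -- The increment of `ψ` up to time `s` is `1`, so `1 ≤ K * length`.
      have h2 := F.abs_sub_le_mul_length hγ (ofBump ψ).contMDiff hK0 hs fun t _ => hK (γ t)
      have h3 : (ofBump ψ).toFun (γ s) = 0 := hψs
      have h4 : (ofBump ψ).toFun (γ 0) = 1 := by rw [h0]; exact hy1
      rw [h3, h4, zero_sub, abs_neg, abs_one] at h2
      refine hyz.trans (mul_le_mul_of_nonneg_left ?_ hC0.le)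
      rw [inv_le_iff_one_le_mul₀ (by positivity)]
      nlinarith [F.length_nonneg γ]
  rw [← div_le_iff₀' hC0]
  refine le_csInf ?_ ?_
  · obtain ⟨γ, hγ, h0, h1⟩ := hseg y hy0 z hz0
    exact ⟨_, γ, hγ, h0, h1, rfl⟩
  · rintro _ ⟨γ, hγ, h0, h1, rfl⟩
    rw [div_le_iff₀' hC0]
    exact hlen γ hγ h0 h1

end C1c

/-! ### Locally Lipschitz functions along absolutely continuous curves. -/

/-- Absolute continuity only tests families of intervals of small total length; once this is below
`δ`, every single interval is shorter than `δ` and the local comparison applies to it. -/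
theorem _root_.AbsolutelyContinuousOnInterval.of_locally_dist_le {X Y : Type*} [PseudoMetricSpace X]
    [PseudoMetricSpace Y] {f : ℝ → X} {g : ℝ → Y} {a b : ℝ}
    (hf : AbsolutelyContinuousOnInterval f a b) {C δ : ℝ} (hδ : 0 < δ)
    (h : ∀ s ∈ uIcc a b, ∀ t ∈ uIcc a b, Dist.dist s t < δ →
      Dist.dist (g s) (g t) ≤ C * Dist.dist (f s) (f t)) :
    AbsolutelyContinuousOnInterval g a b := by
  rw [absolutelyContinuousOnInterval_iff] at hf ⊢
  intro ε hε
  -- `|C| + 1` is a positive upper bound for `C`, whose sign is not known.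
  obtain ⟨η, hη, H⟩ := hf (ε / (|C| + 1)) (by positivity)
  refine ⟨min η δ, lt_min hη hδ, fun I hI hlt => ?_⟩
  have h1 := H I hI (hlt.trans_le (min_le_left _ _))
  rw [lt_div_iff₀' (by positivity), Finset.mul_sum] at h1
  refine lt_of_le_of_lt (Finset.sum_le_sum fun i hi => ?_) h1
  have h2 : Dist.dist (I.2 i).1 (I.2 i).2 < δ :=
    (Finset.single_le_sum (f := fun i => Dist.dist (I.2 i).1 (I.2 i).2)
      (fun _ _ => dist_nonneg) hi).trans_lt (hlt.trans_le (min_le_right _ _))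
  refine (h _ (hI.1 i hi).1 _ (hI.1 i hi).2 h2).trans
    (mul_le_mul_of_nonneg_right ?_ dist_nonneg)
  linarith [le_abs_self C]

namespace IsACCurve

variable {X : Type*} [TopologicalSpace X] {d : X → X → ℝ} {f : X → ℝ} {γ : C(unitInterval, X)}

/-- At nearby times the increment of `f ∘ γ` is at most `K` times that of the primitive of `G`,
which is absolutely continuous. No axiom of a metric is assumed of `d`. -/
theorem absolutelyContinuousOnInterval_comp (hγ : IsACCurve d γ) {K : ℝ} (hK : 0 ≤ K)
    (hf : ∀ x, ∃ V ∈ 𝓝 x, ∀ y ∈ V, ∀ z ∈ V, |f z - f y| ≤ K * d y z) :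
    AbsolutelyContinuousOnInterval (fun t => f (γ (projIcc 0 1 zero_le_one t))) 0 1 := by
  obtain ⟨G, hG, hd⟩ := hγ
  choose V hV hfV using hf
  have hGi : ∀ {s t : ℝ}, s ∈ uIcc (0 : ℝ) 1 → t ∈ uIcc (0 : ℝ) 1 →
      IntervalIntegrable G volume s t := fun hs ht =>
    ((intervalIntegrable_iff_integrableOn_Icc_of_le zero_le_one).2 hG).mono_set
      (uIcc_subset_uIcc hs ht)
  -- A Lebesgue number of the cover of `[0,1]` by preimages of the sets `V x` makes the local
  -- Lipschitz bound uniform in time.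
  obtain ⟨δ, hδ, hδV⟩ := lebesgue_number_lemma_of_metric (isCompact_univ (X := unitInterval))
    (c := fun x => γ ⁻¹' interior (V x)) (fun x => isOpen_interior.preimage γ.continuous)
    fun t _ => mem_iUnion.2 ⟨γ t, mem_interior_iff_mem_nhds.2 (hV _)⟩
  have key : ∀ s ∈ uIcc (0 : ℝ) 1, ∀ t ∈ uIcc (0 : ℝ) 1, s ≤ t → Dist.dist s t < δ →
      Dist.dist (f (γ (projIcc 0 1 zero_le_one s))) (f (γ (projIcc 0 1 zero_le_one t))) ≤
        K * Dist.dist (∫ r in (0 : ℝ)..s, G r) (∫ r in (0 : ℝ)..t, G r) := by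
    intro s hs t ht hst hlt
    have hs' := hs
    have ht' := ht
    rw [uIcc_of_le zero_le_one] at hs' ht'
    rw [projIcc_of_mem _ hs', projIcc_of_mem _ ht']
    obtain ⟨x, hx⟩ := hδV ⟨s, hs'⟩ trivial
    have h1 := hfV x _ (interior_subset (hx (Metric.mem_ball_self hδ))) (γ ⟨t, ht'⟩)
      (interior_subset (hx (by rwa [Metric.mem_ball, dist_comm])))
    have h2 := hd ⟨s, hs'⟩ ⟨t, ht'⟩ hst
    rw [dist_comm, Real.dist_eq, dist_comm, Real.dist_eq,
      intervalIntegral.integral_interval_sub_left (hGi left_mem_uIcc ht) (hGi left_mem_uIcc hs)]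
    exact h1.trans (mul_le_mul_of_nonneg_left (h2.trans (le_abs_self _)) hK)
  refine ((hGi left_mem_uIcc right_mem_uIcc).absolutelyContinuousOnInterval_intervalIntegral
    (left_mem_uIcc (b := (1 : ℝ)))).of_locally_dist_le hδ (C := K) fun s hs t ht hlt => ?_
  rcases le_total s t with h | h
  · exact key s hs t ht h hlt
  · rw [dist_comm, dist_comm (∫ r in (0 : ℝ)..s, G r)]
    exact key t ht s hs h (by rwa [dist_comm])

/-- The derivative of `f ∘ γ` is bounded by the local Lipschitz constant times the speed. -/
theorem ae_enorm_deriv_comp_le (hγ : IsACCurve d γ) {g : X → ℝ} (hg : ∀ x, 0 ≤ g x)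
    (hf : ∀ x, ∀ C, g x < C → ∃ V ∈ 𝓝 x, ∀ y ∈ V, ∀ z ∈ V, |f z - f y| ≤ C * d y z) :
    ∀ᵐ t : unitInterval, ‖deriv (fun t => f (γ (projIcc 0 1 zero_le_one t))) (t : ℝ)‖ₑ ≤
      ENNReal.ofReal (g (γ t)) * metricSpeed d γ t := by
  obtain ⟨G, hG, hd⟩ := hγ
  set φ : ℝ → ℝ := fun t => f (γ (projIcc 0 1 zero_le_one t)) with hφ
  have hφt : ∀ t : unitInterval, φ t = f (γ t) := fun t => by rw [hφ]; simp
  have hGi : IntervalIntegrable G volume 0 1 :=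
    (intervalIntegrable_iff_integrableOn_Icc_of_le zero_le_one).2 hG
  have hGi' : ∀ t : unitInterval, IntervalIntegrable G volume 0 t := fun t =>
    hGi.mono_set (uIcc_subset_uIcc left_mem_uIcc
      (by rw [uIcc_of_le zero_le_one]; exact t.2))
  -- Lebesgue differentiation: at almost every `t` the primitive of `G` has derivative `G t`.
  have hae := unitInterval.measurePreserving_coe.quasiMeasurePreserving.ae
    (ae_restrict_of_ae hGi.ae_hasDerivAt_integral)
  have hne : ∀ᵐ t : unitInterval, t ≠ 0 := Measure.ae_ne volume 0
  filter_upwards [hae, hne] with t hΦ ht0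
  rw [uIcc_of_le zero_le_one] at hΦ
  have hΦt := hΦ t.2 0 ⟨le_rfl, zero_le_one⟩
  by_cases hdiff : DifferentiableAt ℝ φ t
  swap
  -- Where `f ∘ γ` is not differentiable, `deriv` is `0` by default.
  · rw [deriv_zero_of_not_differentiableAt hdiff, enorm_zero]; exact zero_le
  have hlt : (0 : unitInterval) < t := unitInterval.pos_iff_ne_zero.2 ht0
  -- Only `s < t` is used: `d` is not assumed symmetric, and absolute continuity controls `d (γ s)
  -- (γ t)` for `s ≤ t` only. The left upper limit `L` is at most the metric speed, and the
  -- derivative of `f ∘ γ` can be computed from the left.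
  have : NeBot (𝓝[<] t) := nhdsLT_neBot_of_exists_lt ⟨0, hlt⟩
  have hval : Tendsto ((↑) : unitInterval → ℝ) (𝓝[<] t) (𝓝[≠] (t : ℝ)) :=
    (continuous_subtype_val.continuousWithinAt (s := Iio t)).tendsto_nhdsWithin
      fun s hs => (Subtype.coe_lt_coe.2 hs).ne
  have hmem : ∀ᶠ s in 𝓝[<] t, s < t := eventually_mem_nhdsWithin
  set L : ℝ≥0∞ := limsup (fun s : unitInterval =>
    ENNReal.ofReal (d (γ s) (γ t) / |(s : ℝ) - t|)) (𝓝[<] t) with hL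
  have hLspeed : L ≤ metricSpeed d γ t :=
    limsup_le_limsup_of_le (nhdsWithin_mono t fun s (hs : s < t) => hs.ne)
  -- The left quotients are dominated by averages of `G`, which tend to `G t`. Finiteness of `L` is
  -- what permits the limit `C ↓ g (γ t)` below, since `C * ⊤` jumps at `C = 0`.
  have hLtop : L ≠ ⊤ := by
    have h1 := (hasDerivAt_iff_tendsto_slope.1 hΦt).comp hval
    have h2 := (ENNReal.tendsto_ofReal h1).limsup_eq
    refine ne_top_of_le_ne_top (b := ENNReal.ofReal (G t)) ENNReal.ofReal_ne_top ?_
    rw [← h2]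
    refine limsup_le_limsup ?_
    filter_upwards [hmem] with s hs
    have hs' : (s : ℝ) < t := hs
    refine ENNReal.ofReal_le_ofReal ?_
    rw [Function.comp_apply, slope_comm, slope_def_field, abs_sub_comm, abs_of_pos (sub_pos.2 hs'),
      intervalIntegral.integral_interval_sub_left (hGi' t) (hGi' s)]
    exact div_le_div_of_nonneg_right (hd s t hs.le) (sub_pos.2 hs').le
  have hC : ∀ C, g (γ t) < C → ‖deriv φ t‖ₑ ≤ ENNReal.ofReal C * L := by
    intro C hC
    obtain ⟨V, hV, hfV⟩ := hf _ C hC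
    have h1 := ((hasDerivAt_iff_tendsto_slope.1 hdiff.hasDerivAt).comp hval).enorm.limsup_eq
    rw [← h1, hL, ← ENNReal.limsup_const_mul_of_ne_top ENNReal.ofReal_ne_top]
    refine limsup_le_limsup ?_
    filter_upwards [hmem, nhdsWithin_le_nhds (γ.continuous.continuousAt.preimage_mem_nhds hV)]
      with s hs hsV
    have h2 := hfV _ hsV _ (mem_of_mem_nhds hV)
    rw [Function.comp_apply, slope_def_field, hφt, hφt, Real.enorm_eq_ofReal_abs,
      ← ENNReal.ofReal_mul ((hg _).trans hC.le), abs_div, abs_sub_comm (f _), ← mul_div_assoc]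
    exact ENNReal.ofReal_le_ofReal (div_le_div_of_nonneg_right h2 (abs_nonneg _))
  have hlim : Tendsto (fun C => ENNReal.ofReal C * L) (𝓝[>] (g (γ t)))
      (𝓝 (ENNReal.ofReal (g (γ t)) * L)) :=
    ENNReal.Tendsto.mul_const ((ENNReal.continuous_ofReal.tendsto _).mono_left nhdsWithin_le_nhds)
      (Or.inr hLtop)
  exact (ge_of_tendsto hlim (eventually_mem_nhdsWithin.mono hC)).trans
    (mul_le_mul_right hLspeed _)

/-- The fundamental theorem of calculus for the absolutely continuous function `f ∘ γ`. The bound on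
`g` serves only to give a common local Lipschitz constant. -/
theorem enorm_sub_le_lintegral (hγ : IsACCurve d γ) {g : X → ℝ} (hg : ∀ x, 0 ≤ g x)
    {K : ℝ} (hgK : ∀ x, g x ≤ K)
    (hf : ∀ x, ∀ C, g x < C → ∃ V ∈ 𝓝 x, ∀ y ∈ V, ∀ z ∈ V, |f z - f y| ≤ C * d y z) :
    ‖f (γ 1) - f (γ 0)‖ₑ ≤ ∫⁻ t, ENNReal.ofReal (g (γ t)) * metricSpeed d γ t := by
  set φ : ℝ → ℝ := fun t => f (γ (projIcc 0 1 zero_le_one t)) with hφ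
  -- `K + 1` lies strictly above every `g x`, as `hf` demands.
  have hK : 0 ≤ K + 1 := by linarith [hg (γ 0), hgK (γ 0)]
  have hac : AbsolutelyContinuousOnInterval φ 0 1 :=
    hγ.absolutelyContinuousOnInterval_comp hK fun x => hf x _ (by linarith [hgK x])
  have h1 : f (γ 1) - f (γ 0) = ∫ t in Ioc (0 : ℝ) 1, deriv φ t := by
    rw [← intervalIntegral.integral_of_le zero_le_one, hac.integral_deriv_eq_sub, hφ]
    simp
  calc ‖f (γ 1) - f (γ 0)‖ₑ ≤ ∫⁻ t in Ioc (0 : ℝ) 1, ‖deriv φ t‖ₑ := by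
        rw [h1]; exact enorm_integral_le_lintegral_enorm _
    _ = ∫⁻ t in unitInterval, ‖deriv φ t‖ₑ := setLIntegral_congr Ioc_ae_eq_Icc
    _ = ∫⁻ t : unitInterval, ‖deriv φ (t : ℝ)‖ₑ :=
        (unitInterval.measurePreserving_coe.lintegral_comp (measurable_deriv φ).enorm).symm
    _ ≤ _ := lintegral_mono_ae (hγ.ae_enorm_deriv_comp_le hg hf)

end IsACCurve

/-! ### `C¹_c` functions are Sobolev, with `|Df| ≤ F^*(df)`. -/

namespace C1c

variable [FiniteDimensional ℝ E] [MeasurableSpace M] [BorelSpace M] [SecondCountableTopology M]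
  [T2Space M]

/-- The function `x ↦ F^*(x, df(x))`, as an element of `L²(μ)`. -/
def dualNormDiff (F : FinslerStructure E M) (μ : Measure M) [IsFiniteMeasureOnCompacts μ]
    (f : C1c E M) : Lp ℝ 2 μ := (memLp_dualNorm_diff F μ f).toLp

/-- The inequality holds along every absolutely continuous curve for the continuous representative
of `f`. A test plan is concentrated on such curves, and its bounded compression allows the change of
representative at both endpoints. -/
theorem isWeakUpperGradient_dualNormDiff (F : FinslerStructure E M) (μ : Measure M)
    [IsFiniteMeasureOnCompacts μ] (f : C1c E M) :
    IsWeakUpperGradient F.dist (f.toL2 μ) (f.dualNormDiff F μ) := by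
  have hcoe := (memLp_dualNorm_diff F μ f).coeFn_toLp
  refine ⟨?_, fun x => ENNReal.ofReal (F.dualNorm x (diff E f.toFun x)),
    (F.measurable_dualNorm (isMeasurableSection_diff f.contMDiff)).ennreal_ofReal, ?_,
    fun π hπ => lintegral_mono_ae ?_⟩
  · rw [← Lp.coeFn_nonneg]
    filter_upwards [hcoe] with x hx
    rw [dualNormDiff, hx]; exact F.dualNorm_nonneg _ _
  · filter_upwards [hcoe] with x hx
    rw [dualNormDiff, hx]
  · have hf : f.toL2 μ =ᵐ[μ] f.toFun := MemLp.coeFn_toLp _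
    obtain ⟨K, -, hK⟩ := exists_dualNorm_diff_le F f
    filter_upwards [hπ.ae_isACCurve, hπ.ae_comp hf 1, hπ.ae_comp hf 0] with γ hγ h1 h0
    rw [h1, h0]
    exact hγ.enorm_sub_le_lintegral (fun x => F.dualNorm_nonneg x (diff E f.toFun x)) hK
      fun x C hC => exists_abs_sub_le_mul_dist F f.contMDiff x hC

theorem toL2_mem_sobolev (F : FinslerStructure E M) (μ : Measure M) [IsFiniteMeasureOnCompacts μ]
    (f : C1c E M) : f.toL2 μ ∈ sobolev F.dist μ :=
  ⟨_, f.isWeakUpperGradient_dualNormDiff F μ⟩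

/-- The minimal weak upper gradient lies below every weak upper gradient. This is how the geometry
enters the module argument. -/
theorem pnorm_differential_le (F : FinslerStructure E M) (μ : Measure M)
    [IsFiniteMeasureOnCompacts μ] (f : C1c E M) :
    L2NormedModule.pnorm (μ := μ)
      (CotangentModule.differential F.dist μ ⟨f.toL2 μ, f.toL2_mem_sobolev F μ⟩) ≤
    L2NormedModule.pnorm (μ := μ) (f.concreteDiff F μ) := by
  rw [CotangentModule.pnorm_differential]
  exact (isGLB_minimalWeakUpperGradient F.dist _).1 (f.isWeakUpperGradient_dualNormDiff F μ)

end C1c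

/-! ### Elements of `L^∞(μ)` and convergence in `L²(μ)`. -/

namespace Linfty

variable {X : Type*} [MeasurableSpace X] {μ : Measure X}

theorem exists_coeFn_eq {f : X → ℝ} (hf : Measurable f) {K : ℝ} (hK : ∀ x, |f x| ≤ K) :
    ∃ a : Linfty μ, ((a : X →ₘ[μ] ℝ) : X → ℝ) =ᵐ[μ] f := by
  have hm : MemLp f ⊤ μ := memLp_top_of_bound hf.aestronglyMeasurable K (ae_of_all _ hK)
  refine ⟨⟨AEEqFun.mk f hf.aestronglyMeasurable, ?_⟩, AEEqFun.coeFn_mk _ _⟩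
  change eLpNorm (AEEqFun.mk f hf.aestronglyMeasurable : X →ₘ[μ] ℝ) ⊤ μ < ⊤
  rw [eLpNorm_congr_ae (AEEqFun.coeFn_mk _ _)]
  exact hm.2

theorem coeFn_algebraMap (c : ℝ) :
    (((algebraMap ℝ (Linfty μ) c : Linfty μ) : X →ₘ[μ] ℝ) : X → ℝ) =ᵐ[μ] fun _ => c := by
  have h : ((algebraMap ℝ (Linfty μ) c : Linfty μ) : X →ₘ[μ] ℝ) = c • (1 : X →ₘ[μ] ℝ) :=
    Algebra.algebraMap_eq_smul_one c
  rw [h]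
  filter_upwards [AEEqFun.coeFn_smul c (1 : X →ₘ[μ] ℝ), AEEqFun.coeFn_one (β := ℝ) (μ := μ)]
    with x h1 h2
  rw [h1, Pi.smul_apply, h2]
  simp

theorem coeFn_sub (a b : Linfty μ) :
    (((a - b : Linfty μ) : X →ₘ[μ] ℝ) : X → ℝ) =ᵐ[μ] fun x =>
      (a : X →ₘ[μ] ℝ) x - (b : X →ₘ[μ] ℝ) x :=
  AEEqFun.coeFn_sub (a : X →ₘ[μ] ℝ) (b : X →ₘ[μ] ℝ)

end Linfty

/-- Dominated convergence for the squares, with integrable majorant `g²`. -/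
theorem tendsto_Lp_zero_of_dominated {X : Type*} [MeasurableSpace X] {μ : Measure X}
    {v : ℕ → Lp ℝ 2 μ} {g : Lp ℝ 2 μ} (hb : ∀ n, ∀ᵐ x ∂μ, |v n x| ≤ |g x|)
    (hlim : ∀ᵐ x ∂μ, Tendsto (fun n => v n x) atTop (𝓝 0)) : Tendsto v atTop (𝓝 0) := by
  have hsq : ∀ w : Lp ℝ 2 μ, ‖w‖ ^ 2 = ∫ x, w x ^ 2 ∂μ := fun w => by
    rw [← real_inner_self_eq_norm_sq, L2.inner_def]
    simp [sq]
  have h1 : Tendsto (fun n => ∫ x, v n x ^ 2 ∂μ) atTop (𝓝 (∫ _, (0 : ℝ) ∂μ)) := by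
    refine tendsto_integral_of_dominated_convergence (fun x => g x ^ 2)
      (fun n => (Lp.aestronglyMeasurable _).pow 2) (Lp.memLp g).integrable_sq (fun n => ?_) ?_
    · filter_upwards [hb n] with x hx
      rw [Real.norm_eq_abs, abs_pow, ← sq_abs (g x)]
      exact pow_le_pow_left₀ (abs_nonneg _) hx 2
    · filter_upwards [hlim] with x hx
      simpa using hx.pow 2
  rw [tendsto_zero_iff_norm_tendsto_zero]
  have h2 := (Real.continuous_sqrt.tendsto _).comp h1
  simpa [Function.comp_def, ← hsq] using h2

/-! ### Pointwise estimates in `L²`-normed modules. -/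

namespace L2NormedModule

variable {X : Type*} [MeasurableSpace X] {μ : Measure X}
  {T : Type*} [NormedAddCommGroup T] [Module (Linfty μ) T] [L2NormedModule μ T]

theorem norm_smul_le {a : Linfty μ} {K : ℝ} (hK : ∀ᵐ x ∂μ, |(a : X →ₘ[μ] ℝ) x| ≤ K) (v : T) :
    ‖a • v‖ ≤ K * ‖v‖ := by
  rw [← norm_pnorm (μ := μ) (a • v), ← norm_pnorm (μ := μ) v]
  refine Lp.norm_le_mul_norm_of_ae_le_mul ?_
  filter_upwards [hK, pnorm_smul a v] with x h1 h2
  rw [h2, norm_mul, Real.norm_eq_abs, abs_abs]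
  exact mul_le_mul_of_nonneg_right h1 (norm_nonneg _)

theorem continuous_const_smul (a : Linfty μ) : Continuous fun v : T => a • v := by
  obtain ⟨K, hK0, hK⟩ := exists_ae_bound a
  refine (LipschitzWith.of_dist_le_mul (K := ⟨K, hK0⟩) fun v w => ?_).continuous
  rw [dist_eq_norm, dist_eq_norm, ← smul_sub]
  exact norm_smul_le hK _

variable [NormedSpace ℝ T]

theorem continuous_pnorm (hT : IsPointwiseSeminorm (pnorm : T → Lp ℝ 2 μ)) :
    Continuous (pnorm : T → Lp ℝ 2 μ) := by
  refine (LipschitzWith.of_dist_le_mul (K := 1) fun v w => ?_).continuous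
  rw [dist_eq_norm, dist_eq_norm, NNReal.coe_one, one_mul, ← norm_pnorm (μ := μ) (v - w)]
  exact hT.norm_sub_le v w

variable {ι : Type*} [Fintype ι]

/-- Lipschitz dependence of the pointwise norm on the coefficients, by the triangle inequality for
`∑ a_i v_i = ∑ b_i v_i + ∑ (a_i - b_i) v_i`. It is used to compare `L^∞` coefficients with rational
constants at a fixed point. -/
theorem pnorm_sum_smul_le_add (hT : IsPointwiseSeminorm (pnorm : T → Lp ℝ 2 μ)) (v : ι → T)
    (a b : ι → Linfty μ) :
    ∀ᵐ x ∂μ, pnorm (μ := μ) (∑ i, a i • v i) x ≤ pnorm (μ := μ) (∑ i, b i • v i) x +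
      ∑ i, |(a i : X →ₘ[μ] ℝ) x - (b i : X →ₘ[μ] ℝ) x| * pnorm (μ := μ) (v i) x := by
  have h0 : pnorm (μ := μ) (0 : T) = 0 := by simpa using hT.smul 0 0
  have h1 : ∑ i, a i • v i = ∑ i, b i • v i + ∑ i, (a i - b i) • v i := by
    rw [← Finset.sum_add_distrib]
    refine Finset.sum_congr rfl fun i _ => ?_
    rw [← add_smul, add_sub_cancel]
  have h2 : pnorm (μ := μ) (∑ i, a i • v i) ≤
      pnorm (μ := μ) (∑ i, b i • v i) + ∑ i, pnorm (μ := μ) ((a i - b i) • v i) := by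
    rw [h1]
    exact (hT.add_le _ _).trans (add_le_add_right
      (Finset.le_sum_of_subadditive _ h0.le hT.add_le _ _) _)
  rw [← Lp.coeFn_le] at h2
  filter_upwards [h2, Lp.coeFn_add (pnorm (μ := μ) (∑ i, b i • v i))
    (∑ i, pnorm (μ := μ) ((a i - b i) • v i)), Lp.coeFn_finsetSum Finset.univ
    fun i => pnorm (μ := μ) ((a i - b i) • v i),
    eventually_countable_forall.2 fun i => pnorm_smul (a i - b i) (v i),
    eventually_countable_forall.2 fun i => Linfty.coeFn_sub (a i) (b i)] with x e1 e2 e3 e4 e5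
  rw [e2, Pi.add_apply, e3, Finset.sum_apply] at e1
  simpa only [e4, e5] using e1

/-- A pointwise estimate for linear combinations with constant coefficients extends to
coefficients in `L^∞(μ)`. -/
theorem pnorm_sum_smul_le [IsScalarTower ℝ (Linfty μ) T]
    {T' : Type*} [NormedAddCommGroup T'] [NormedSpace ℝ T'] [Module (Linfty μ) T']
    [L2NormedModule μ T'] [IsScalarTower ℝ (Linfty μ) T']
    (hT : IsPointwiseSeminorm (pnorm : T → Lp ℝ 2 μ))
    (hT' : IsPointwiseSeminorm (pnorm : T' → Lp ℝ 2 μ)) (v : ι → T) (w : ι → T')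
    (h : ∀ c : ι → ℝ, pnorm (μ := μ) (∑ i, c i • w i) ≤ pnorm (μ := μ) (∑ i, c i • v i))
    (a : ι → Linfty μ) :
    pnorm (μ := μ) (∑ i, a i • w i) ≤ pnorm (μ := μ) (∑ i, a i • v i) := by
  -- There are countably many rational coefficient vectors, so all the a.e. statements about them
  -- hold off one null set, and the vector may then be chosen depending on `x`.
  let b : (ι → ℚ) → ι → Linfty μ := fun q i => algebraMap ℝ (Linfty μ) (q i)
  have hq : ∀ᵐ x ∂μ, ∀ q : ι → ℚ, pnorm (μ := μ) (∑ i, b q i • w i) x ≤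
      pnorm (μ := μ) (∑ i, b q i • v i) x := eventually_countable_forall.2 fun q => by
    have := h fun i => q i
    rw [← Lp.coeFn_le] at this
    simp only [b, algebraMap_smul]
    exact this
  have hb : ∀ᵐ x ∂μ, ∀ (q : ι → ℚ) (i : ι), (b q i : X →ₘ[μ] ℝ) x = q i :=
    eventually_countable_forall.2 fun q => eventually_countable_forall.2 fun i =>
      Linfty.coeFn_algebraMap _
  rw [← Lp.coeFn_le]
  filter_upwards [hq, hb,
    eventually_countable_forall.2 fun q => pnorm_sum_smul_le_add hT' w a (b q),
    eventually_countable_forall.2 fun q => pnorm_sum_smul_le_add hT v (b q) a,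
    eventually_countable_forall.2 fun i => (Lp.coeFn_nonneg _).2 (hT.nonneg (v i)),
    eventually_countable_forall.2 fun i => (Lp.coeFn_nonneg _).2 (hT'.nonneg (w i))]
    with x h1 h2 h3 h4 h5 h6
  simp only [h2] at h3 h4
  set S : ℝ := ∑ i, (pnorm (μ := μ) (v i) x + pnorm (μ := μ) (w i) x) with hS
  have hS0 : 0 ≤ S := Finset.sum_nonneg fun i _ => add_nonneg (h5 i) (h6 i)
  refine le_of_forall_pos_le_add fun ε hε => ?_
  have hη : 0 < ε / (S + 1) := by positivity
  -- At the given `x`, rationals so close to the values `a i x` that both replacement errors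
  -- together cost at most `ε`; the `+ 1` guards against `S = 0`.
  choose q hq1 hq2 using fun i =>
    exists_rat_btwn (lt_add_of_pos_right ((a i : X →ₘ[μ] ℝ) x) hη)
  have hle : ∀ i, |(a i : X →ₘ[μ] ℝ) x - q i| ≤ ε / (S + 1) := fun i => by
    rw [abs_le]; constructor <;> linarith [hq1 i, hq2 i]
  have e1 : ∑ i, |(a i : X →ₘ[μ] ℝ) x - q i| * pnorm (μ := μ) (w i) x +
      ∑ i, |(q i : ℝ) - (a i : X →ₘ[μ] ℝ) x| * pnorm (μ := μ) (v i) x ≤ ε / (S + 1) * S := by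
    rw [hS, Finset.mul_sum, ← Finset.sum_add_distrib]
    refine Finset.sum_le_sum fun i _ => ?_
    rw [abs_sub_comm (q i : ℝ), mul_add, add_comm]
    exact add_le_add (mul_le_mul_of_nonneg_right (hle i) (h5 i))
      (mul_le_mul_of_nonneg_right (hle i) (h6 i))
  have e2 : ε / (S + 1) * S ≤ ε := by
    rw [div_mul_eq_mul_div, div_le_iff₀ (by positivity)]
    nlinarith
  -- From `a` to `q` on the side of `w`, the hypothesis for the constants `q`, and back from `q` to
  -- `a` on the side of `v`.
  linarith [h1 q, h3 q, h4 q]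

end L2NormedModule

/-- Both conditions are closed, and they hold on the dense set of simple forms. -/
theorem CotangentModule.isPointwiseSeminorm_pnorm {X : Type*} [TopologicalSpace X]
    [MeasurableSpace X] [BorelSpace X] {d : X → X → ℝ} {m : Measure X} :
    IsPointwiseSeminorm (L2NormedModule.pnorm : CotangentModule d m → Lp ℝ 2 m) := by
  refine ⟨L2NormedModule.pnorm_nonneg, fun v w => ?_, fun c v => ?_⟩
  · change pnorm (v + w) ≤ pnorm v + pnorm w
    induction v, w using UniformSpace.Completion.induction_on₂ with
    | hp => exact isClosed_le (continuous_pnorm.comp continuous_add)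
              ((continuous_pnorm.comp continuous_fst).add (continuous_pnorm.comp continuous_snd))
    | ih v w =>
      rw [← UniformSpace.Completion.coe_add, pnorm_coe, pnorm_coe, pnorm_coe]
      exact SimpleForm.isPointwiseSeminorm.add_le v w
  · change pnorm (c • v) = |c| • pnorm v
    induction v using UniformSpace.Completion.induction_on with
    | hp => exact isClosed_eq (continuous_pnorm.comp (continuous_const_smul c))
              (continuous_pnorm.const_smul |c|)
    | ih v =>
      rw [← UniformSpace.Completion.coe_smul, pnorm_coe, pnorm_coe]
      exact SimpleForm.isPointwiseSeminorm.smul c v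

theorem FinslerStructure.Gamma2.isPointwiseSeminorm_pnorm [FiniteDimensional ℝ E]
    [MeasurableSpace M] [BorelSpace M] [SecondCountableTopology M] {F : FinslerStructure E M}
    {μ : Measure M} :
    IsPointwiseSeminorm (L2NormedModule.pnorm : F.Gamma2 μ → Lp ℝ 2 μ) := by
  refine ⟨L2NormedModule.pnorm_nonneg, fun v w => ?_, fun c v => ?_⟩
  · obtain ⟨ω, rfl⟩ := SeparationQuotient.surjective_mk v
    obtain ⟨η, rfl⟩ := SeparationQuotient.surjective_mk w
    exact L2Sections.isPointwiseSeminorm.add_le ω η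
  · obtain ⟨ω, rfl⟩ := SeparationQuotient.surjective_mk v
    exact L2Sections.isPointwiseSeminorm.smul c ω

/-! ### Linear operations on `C¹_c(M)` and local frames of differentials. -/

namespace C1c

variable [FiniteDimensional ℝ E]

/-- Bare operations are enough: the vector space axioms are only used in the target modules, where
the differentials take their values. -/
instance : Add (C1c E M) :=
  ⟨fun f g => ⟨f.toFun + g.toFun, f.contMDiff.add g.contMDiff,
    f.hasCompactSupport.add g.hasCompactSupport⟩⟩

instance : SMul ℝ (C1c E M) :=
  ⟨fun c f => ⟨c • f.toFun, (contDiff_const_smul c).contMDiff.comp f.contMDiff, f.hasCompactSupport.smul_left⟩⟩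

instance : Zero (C1c E M) := ⟨⟨0, contMDiff_const, HasCompactSupport.zero⟩⟩

section Frame

variable [T2Space M]

/-- A bump function times a linear function of the coordinates. -/
def ofChart {x : M} (ψ : SmoothBumpFunction 𝓘(ℝ, E) x) (l : E →L[ℝ] ℝ) : C1c E M where
  toFun y := ψ y • l (extChartAt 𝓘(ℝ, E) x y)
  contMDiff := (ψ.contMDiff_smul
    (l.contMDiff.comp_contMDiffOn contMDiffOn_extChartAt)).of_le (by norm_cast)
  hasCompactSupport := ψ.hasCompactSupport.smul_right

/-- Near `y` the cut-off is invisible, and the trivialization of the tangent bundle is the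
derivative of the chart. -/
theorem diff_ofChart {x y : M} (ψ : SmoothBumpFunction 𝓘(ℝ, E) x) (l : E →L[ℝ] ℝ)
    (hy : y ∈ (chartAt E x).source) (hψ : ψ =ᶠ[𝓝 y] 1) (v : TangentSpace 𝓘(ℝ, E) y) :
    diff E (ofChart ψ l).toFun y v =
      l ((trivializationAt E (TangentSpace 𝓘(ℝ, E)) x).continuousLinearMapAt ℝ y v) := by
  rw [TangentBundle.continuousLinearMapAt_trivializationAt hy]
  have h1 : (ofChart ψ l).toFun =ᶠ[𝓝 y] l ∘ extChartAt 𝓘(ℝ, E) x := by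
    filter_upwards [hψ] with z hz
    change ψ z • l (extChartAt 𝓘(ℝ, E) x z) = l (extChartAt 𝓘(ℝ, E) x z)
    rw [hz, Pi.one_apply, one_smul]
  have h2 := (l.hasMFDerivAt.comp y
    (mdifferentiableAt_extChartAt (I := 𝓘(ℝ, E)) hy).hasMFDerivAt).congr_of_eventuallyEq h1
  exact congrArg (fun L : E →L[ℝ] ℝ => L v) h2.mfderiv

/-- Near every point the cotangent bundle has a frame of differentials of `C¹_c`-functions. -/
theorem exists_frame (x₀ : M) : ∃ W : Set M, IsOpen W ∧ x₀ ∈ W ∧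
    ∃ f : Fin (Module.finrank ℝ E) → C1c E M, ∀ x ∈ W, ∀ η : TangentSpace 𝓘(ℝ, E) x →L[ℝ] ℝ,
      η = ∑ i, η ((trivializationAt E (TangentSpace 𝓘(ℝ, E)) x₀).symmL ℝ x
        (Module.finBasis ℝ E i)) • diff E (f i).toFun x := by
  set b := Module.finBasis ℝ E
  set e := trivializationAt E (TangentSpace 𝓘(ℝ, E)) x₀ with he
  obtain ⟨ψ⟩ : Nonempty (SmoothBumpFunction 𝓘(ℝ, E) x₀) := inferInstance
  -- Requiring `ψ = 1` on a neighbourhood of `y`, not only at `y`, makes the set open and keeps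
  -- derivatives of `ψ` out of the differentials. There the cut-off coordinates have as
  -- differentials the dual of the coordinate frame.
  refine ⟨(chartAt E x₀).source ∩ {y | ∀ᶠ z in 𝓝 y, ψ z = 1},
    (chartAt E x₀).open_source.inter isOpen_setOfPred_eventually_nhds,
    ⟨mem_chart_source E x₀, ψ.eventuallyEq_one⟩,
    fun i => ofChart ψ (LinearMap.toContinuousLinearMap (b.coord i)), ?_⟩
  rintro x ⟨hx, hψ⟩ η
  have hx' : x ∈ e.baseSet := by simpa [he] using hx
  ext v
  have h1 : v = e.symmL ℝ x (∑ i, b.repr (e.continuousLinearMapAt ℝ x v) i • b i) := by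
    rw [b.sum_repr, e.symmL_continuousLinearMapAt (R := ℝ) hx']
  have h2 : η v = ∑ i, b.repr (e.continuousLinearMapAt ℝ x v) i * η (e.symmL ℝ x (b i)) := by
    conv_lhs => rw [h1]
    simp only [map_sum, map_smul, smul_eq_mul]
  rw [h2, _root_.sum_apply]
  refine Finset.sum_congr rfl fun i _ => ?_
  rw [_root_.smul_apply, diff_ofChart ψ _ hx hψ, smul_eq_mul, mul_comm]
  rfl

end Frame

variable [MeasurableSpace M] [BorelSpace M] [SecondCountableTopology M]

section Linear

variable (F : FinslerStructure E M) (μ : Measure M) [IsFiniteMeasureOnCompacts μ]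

theorem concreteDiff_add (f g : C1c E M) :
    (f + g).concreteDiff F μ = f.concreteDiff F μ + g.concreteDiff F μ :=
  FinslerStructure.Gamma2.mk_eq_mk.2 (ae_of_all _ (diff_add f.contMDiff g.contMDiff))

theorem concreteDiff_smul (c : ℝ) (f : C1c E M) :
    (c • f).concreteDiff F μ = c • f.concreteDiff F μ :=
  FinslerStructure.Gamma2.mk_eq_mk.2 (ae_of_all _ (diff_smul c f.contMDiff))

theorem concreteDiff_zero : (0 : C1c E M).concreteDiff F μ = 0 := by
  refine FinslerStructure.Gamma2.mk_eq_mk.2 (ae_of_all _ fun x => ?_)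
  exact diff_eq_zero_of_notMem_tsupport (by rw [show (0 : C1c E M).toFun = 0 from rfl]; simp)

variable [T2Space M]

/-- The differential of `f ∈ C¹_c(M)` in the cotangent module. -/
def abstractDiff (f : C1c E M) : CotangentModule F.dist μ :=
  CotangentModule.differential F.dist μ ⟨f.toL2 μ, f.toL2_mem_sobolev F μ⟩

theorem abstractDiff_add (f g : C1c E M) :
    (f + g).abstractDiff F μ = f.abstractDiff F μ + g.abstractDiff F μ := by
  rw [abstractDiff, abstractDiff, abstractDiff, ← map_add]
  rfl

theorem abstractDiff_smul (c : ℝ) (f : C1c E M) :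
    (c • f).abstractDiff F μ = c • f.abstractDiff F μ := by
  rw [abstractDiff, abstractDiff, ← map_smul]
  rfl

theorem abstractDiff_zero : (0 : C1c E M).abstractDiff F μ = 0 := by
  rw [abstractDiff, ← map_zero (CotangentModule.differential F.dist μ)]
  rfl

/-- The pairs (concrete differential, abstract differential) form a linear subspace of the product,
so one function realises both combinations at once. -/
theorem exists_linearCombination {ι : Type*} [Fintype ι] (f : ι → C1c E M) (c : ι → ℝ) :
    ∃ g : C1c E M, g.concreteDiff F μ = ∑ i, c i • (f i).concreteDiff F μ ∧
      g.abstractDiff F μ = ∑ i, c i • (f i).abstractDiff F μ := by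
  let R : Submodule ℝ (F.Gamma2 μ × CotangentModule F.dist μ) :=
    { carrier := range fun g : C1c E M => (g.concreteDiff F μ, g.abstractDiff F μ)
      add_mem' := by
        rintro _ _ ⟨g, rfl⟩ ⟨h, rfl⟩
        exact ⟨g + h, Prod.ext (concreteDiff_add F μ g h) (abstractDiff_add F μ g h)⟩
      zero_mem' := ⟨0, Prod.ext (concreteDiff_zero F μ) (abstractDiff_zero F μ)⟩
      smul_mem' := by
        rintro c _ ⟨g, rfl⟩
        exact ⟨c • g, Prod.ext (concreteDiff_smul F μ c g) (abstractDiff_smul F μ c g)⟩ }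
  obtain ⟨g, hg⟩ : ∑ i, c i • ((f i).concreteDiff F μ, (f i).abstractDiff F μ) ∈ R :=
    R.sum_mem fun i _ => R.smul_mem _ ⟨f i, rfl⟩
  refine ⟨g, ?_, ?_⟩
  · simpa [Prod.fst_sum] using congrArg Prod.fst hg
  · simpa [Prod.snd_sum] using congrArg Prod.snd hg

/-- For constant coefficients both sides are differentials of a single function. The estimate also
shows that the operator is well defined on combinations of concrete differentials. -/
theorem pnorm_sum_smul_abstractDiff_le {ι : Type*} [Fintype ι] (f : ι → C1c E M)
    (a : ι → Linfty μ) :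
    L2NormedModule.pnorm (μ := μ) (∑ i, a i • (f i).abstractDiff F μ) ≤
      L2NormedModule.pnorm (μ := μ) (∑ i, a i • (f i).concreteDiff F μ) := by
  refine L2NormedModule.pnorm_sum_smul_le FinslerStructure.Gamma2.isPointwiseSeminorm_pnorm
    CotangentModule.isPointwiseSeminorm_pnorm _ _ (fun c => ?_) a
  obtain ⟨g, h1, h2⟩ := exists_linearCombination F μ f c
  rw [← h1, ← h2]
  exact g.pnorm_differential_le F μ

end Linear

end C1c

/-! ### Characteristic functions and cut-offs in modules. -/

theorem abs_indicator_one_le {X : Type*} (A : Set X) (x : X) : |A.indicator (1 : X → ℝ) x| ≤ 1 := by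
  by_cases h : x ∈ A <;> simp [h]

namespace Linfty

variable {X : Type*} [MeasurableSpace X] {μ : Measure X}

theorem ext {a b : Linfty μ} (h : ((a : X →ₘ[μ] ℝ) : X → ℝ) =ᵐ[μ] (b : X →ₘ[μ] ℝ)) : a = b :=
  Subtype.ext (AEEqFun.ext h)

theorem coeFn_one : (((1 : Linfty μ) : X →ₘ[μ] ℝ) : X → ℝ) =ᵐ[μ] 1 := AEEqFun.coeFn_one

theorem coeFn_add (a b : Linfty μ) :
    (((a + b : Linfty μ) : X →ₘ[μ] ℝ) : X → ℝ) =ᵐ[μ] fun x =>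
      (a : X →ₘ[μ] ℝ) x + (b : X →ₘ[μ] ℝ) x :=
  AEEqFun.coeFn_add (a : X →ₘ[μ] ℝ) (b : X →ₘ[μ] ℝ)

theorem coeFn_mul (a b : Linfty μ) :
    (((a * b : Linfty μ) : X →ₘ[μ] ℝ) : X → ℝ) =ᵐ[μ] fun x =>
      (a : X →ₘ[μ] ℝ) x * (b : X →ₘ[μ] ℝ) x :=
  AEEqFun.coeFn_mul (a : X →ₘ[μ] ℝ) (b : X →ₘ[μ] ℝ)

/-- The characteristic function of a measurable set. -/
def ind {A : Set X} (hA : MeasurableSet A) : Linfty μ :=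
  (exists_coeFn_eq (measurable_one.indicator hA) (abs_indicator_one_le A)).choose

theorem coeFn_ind {A : Set X} (hA : MeasurableSet A) :
    (((ind hA : Linfty μ) : X →ₘ[μ] ℝ) : X → ℝ) =ᵐ[μ] A.indicator 1 :=
  (exists_coeFn_eq (measurable_one.indicator hA) (abs_indicator_one_le A)).choose_spec

theorem ind_union {A B : Set X} (hA : MeasurableSet A) (hB : MeasurableSet B) :
    (ind (hA.union hB) : Linfty μ) = ind hA + (1 - ind hA) * ind hB := by
  refine ext ?_
  filter_upwards [coeFn_ind (μ := μ) hA, coeFn_ind (μ := μ) hB, coeFn_ind (μ := μ) (hA.union hB),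
    coeFn_add (ind hA : Linfty μ) ((1 - ind hA) * ind hB),
    coeFn_mul (1 - ind hA : Linfty μ) (ind hB), coeFn_sub (1 : Linfty μ) (ind hA),
    coeFn_one (μ := μ)] with x h1 h2 h3 h4 h5 h6 h7
  rw [h3, h4, h5, h6, h7, h1, h2]
  by_cases hxA : x ∈ A <;> by_cases hxB : x ∈ B <;> simp [hxA, hxB]

theorem ind_empty : (ind MeasurableSet.empty : Linfty μ) = 0 := by
  refine ext ?_
  filter_upwards [coeFn_ind (μ := μ) (MeasurableSet.empty (α := X)),
    AEEqFun.coeFn_zero (β := ℝ) (μ := μ)] with x h1 h2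
  rw [h1, indicator_empty]
  exact h2.symm

/-- Induction on `s` by `χ_{A ∪ B} = χ_A + (1 - χ_A) χ_B`: closure of `D` under `L^∞(μ)` takes care
of overlaps, so the sets need not be made disjoint. -/
theorem ind_biUnion_smul_mem {T : Type*} [AddCommGroup T] [Module (Linfty μ) T]
    (D : Submodule (Linfty μ) T) {v : T} {ι : Type*} (s : Finset ι) {A : ι → Set X}
    (hA : ∀ i, MeasurableSet (A i)) (h : ∀ i, ind (μ := μ) (hA i) • v ∈ D) :
    ind (μ := μ) (s.measurableSet_biUnion fun i _ => hA i) • v ∈ D := by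
  classical
  induction s using Finset.induction_on with
  | empty =>
    have : (ind ((∅ : Finset ι).measurableSet_biUnion fun i _ => hA i) : Linfty μ) = 0 := by
      rw [← ind_empty]
      congr 1
      simp
    rw [this, zero_smul]
    exact D.zero_mem
  | insert i s _ ih =>
    have : (ind ((insert i s).measurableSet_biUnion fun i _ => hA i) : Linfty μ) =
        ind (hA i) + (1 - ind (hA i)) * ind (s.measurableSet_biUnion fun i _ => hA i) := by
      rw [← ind_union]
      congr 1
      simp
    rw [this, add_smul, mul_smul]
    exact D.add_mem (h i) (D.smul_mem _ ih)

end Linfty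

/-- The pointwise norm of `χ_{A n} v - v` is `|v|` off `A n` and `0` on it: it is dominated by `|v|`
and eventually zero at each point. -/
theorem L2NormedModule.tendsto_ind_smul {X : Type*} [MeasurableSpace X] {μ : Measure X}
    {T : Type*} [NormedAddCommGroup T] [Module (Linfty μ) T] [L2NormedModule μ T]
    {A : ℕ → Set X} (hA : ∀ n, MeasurableSet (A n)) (hx : ∀ x, ∀ᶠ n in atTop, x ∈ A n) (v : T) :
    Tendsto (fun n => (Linfty.ind (hA n) : Linfty μ) • v) atTop (𝓝 v) := by
  have hval : ∀ n, ∀ᵐ x ∂μ, pnorm (μ := μ) ((Linfty.ind (hA n) : Linfty μ) • v - v) x =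
      (A n)ᶜ.indicator (pnorm (μ := μ) v) x := by
    intro n
    have h1 : (Linfty.ind (hA n) : Linfty μ) • v - v = ((Linfty.ind (hA n) : Linfty μ) - 1) • v := by
      rw [sub_smul, one_smul]
    rw [h1]
    filter_upwards [pnorm_smul ((Linfty.ind (hA n) : Linfty μ) - 1) v,
      Linfty.coeFn_sub (Linfty.ind (hA n) : Linfty μ) 1, Linfty.coeFn_one (μ := μ),
      Linfty.coeFn_ind (μ := μ) (hA n)] with x e1 e2 e3 e4
    rw [e1, e2, e3, e4]
    by_cases h : x ∈ A n <;> simp [h]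
  rw [tendsto_iff_norm_sub_tendsto_zero]
  have h2 := tendsto_Lp_zero_of_dominated (v := fun n =>
    pnorm (μ := μ) ((Linfty.ind (hA n) : Linfty μ) • v - v)) (g := pnorm (μ := μ) v)
    (fun n => by
      filter_upwards [hval n] with x h
      rw [h]
      by_cases h : x ∈ A n <;> simp [h])
    (by
      filter_upwards [eventually_countable_forall.2 hval] with x h
      refine tendsto_const_nhds.congr' ?_
      filter_upwards [hx x] with n hn
      rw [h n, indicator_of_notMem (notMem_compl_iff.2 hn)])
  simpa only [norm_pnorm, norm_zero] using h2.norm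

/-! ### Density of the span of differentials in `Γ₂(T^*M; μ)`. -/

section

variable [FiniteDimensional ℝ E] [MeasurableSpace M] [BorelSpace M] [SecondCountableTopology M]

theorem FinslerStructure.L2Sections.val_sum {ι : Type*} {F : FinslerStructure E M} {μ : Measure M}
    (s : Finset ι) (ω : ι → F.L2Sections μ) (x : M) :
    (∑ i ∈ s, ω i).val x = ∑ i ∈ s, (ω i).val x :=
  map_sum (⟨⟨fun η : F.L2Sections μ => η.val x, rfl⟩, fun _ _ => rfl⟩ :
    F.L2Sections μ →+ (TangentSpace 𝓘(ℝ, E) x →L[ℝ] ℝ)) ω s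

variable (F : FinslerStructure E M) (μ : Measure M) [IsFiniteMeasureOnCompacts μ]

namespace FinslerStructure

/-- On `S` the coefficients of `ω` in the frame are bounded, so, extended by zero, they are elements
of `L^∞(μ)`. -/
theorem ind_smul_mem_span {ι : Type*} [Fintype ι] (ω : F.L2Sections μ) {S : Set M}
    (hS : MeasurableSet S) (f : ι → C1c E M) {a : ι → M → ℝ} (ha : ∀ i, Measurable (a i)) {K : ℝ}
    (hK : ∀ i, ∀ x ∈ S, |a i x| ≤ K)
    (hω : ∀ x ∈ S, ω.val x = ∑ i, a i x • diff E (f i).toFun x) :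
    (Linfty.ind hS : Linfty μ) • (SeparationQuotient.mk ω : F.Gamma2 μ) ∈
      Submodule.span (Linfty μ) (range fun f : C1c E M => f.concreteDiff F μ) := by
  -- `|K|` rather than `K`: if `S` is empty, `K` may be negative.
  have hb : ∀ i x, |S.indicator (a i) x| ≤ |K| := fun i x => by
    by_cases h : x ∈ S
    · rw [indicator_of_mem h]; exact (hK i x h).trans (le_abs_self K)
    · rw [indicator_of_notMem h, abs_zero]; exact abs_nonneg K
  choose c hc using fun i => Linfty.exists_coeFn_eq (μ := μ) ((ha i).indicator hS) (hb i)
  have hη : ∀ i, ∃ η : F.L2Sections μ, (f i).concreteDiff F μ = SeparationQuotient.mk η ∧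
      ∀ x, η.val x = diff E (f i).toFun x := fun i => ⟨_, rfl, fun _ => rfl⟩
  choose η hη hηv using hη
  have hmk : ∑ i, c i • (f i).concreteDiff F μ =
      SeparationQuotient.mk (∑ i, L2Sections.mul (c i) (η i)) := by
    simp only [hη]
    exact (map_sum (⟨⟨SeparationQuotient.mk, rfl⟩, fun _ _ => rfl⟩ : F.L2Sections μ →+ F.Gamma2 μ)
      _ _).symm
  have heq : (Linfty.ind hS : Linfty μ) • (SeparationQuotient.mk ω : F.Gamma2 μ) =
      ∑ i, c i • (f i).concreteDiff F μ := by
    rw [hmk, Gamma2.smul_mk, Gamma2.mk_eq_mk]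
    filter_upwards [Linfty.coeFn_ind (μ := μ) hS, eventually_countable_forall.2 hc] with x h1 h2
    rw [L2Sections.val_mul, L2Sections.val_sum, h1]
    simp only [L2Sections.val_mul, hηv, h2]
    by_cases h : x ∈ S
    · simp only [indicator_of_mem h, Pi.one_apply, one_smul]
      exact hω x h
    · simp only [indicator_of_notMem h, zero_smul, Finset.sum_const_zero]
  rw [heq]
  exact Submodule.sum_mem _ fun i _ => Submodule.smul_mem _ _ (Submodule.subset_span ⟨f i, rfl⟩)

/-- The differentials of `C¹_c`-functions generate `Γ₂(T^*M; μ)`. -/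
theorem dense_span_concreteDiff [T2Space M] [Nonempty M] :
    Dense (Submodule.span (Linfty μ) (range fun f : C1c E M => f.concreteDiff F μ) :
      Set (F.Gamma2 μ)) := by
  choose W hWo hxW f hf using C1c.exists_frame (E := E) (M := M)
  obtain ⟨s, hs, hcov⟩ := TopologicalSpace.countable_cover_nhds fun x =>
    (hWo x).mem_nhds (hxW x)
  -- Nonemptiness of the countable index set allows its enumeration by `ℕ`, possibly with
  -- repetitions.
  have hsne : s.Nonempty := by
    obtain ⟨x⟩ := ‹Nonempty M›
    have hx : x ∈ ⋃ x ∈ s, W x := hcov ▸ mem_univ x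
    obtain ⟨y, hy, -⟩ := mem_iUnion₂.1 hx
    exact ⟨y, hy⟩
  obtain ⟨p, rfl⟩ := hs.exists_eq_range hsne
  intro v
  obtain ⟨ω, rfl⟩ := SeparationQuotient.surjective_mk v
  let a : ℕ → Fin (Module.finrank ℝ E) → M → ℝ := fun k i x => ω.val x
    ((trivializationAt E (TangentSpace 𝓘(ℝ, E)) (p k)).symmL ℝ x (Module.finBasis ℝ E i))
  have ha : ∀ k i, Measurable (a k i) := fun k i => ω.measurable _ _
  -- The part of the `k`-th frame domain where all coefficients of `ω` are at most `n`. The sections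
  -- `χ_{⋃_{k < n} S n k} ω` lie in the span and converge to `ω`.
  let S : ℕ → ℕ → Set M := fun n k => W (p k) ∩ ⋂ i, {x | |a k i x| ≤ n}
  have hS : ∀ n k, MeasurableSet (S n k) := fun n k => (hWo _).measurableSet.inter
    (MeasurableSet.iInter fun i => measurableSet_le (ha k i).abs measurable_const)
  refine mem_closure_of_tendsto (L2NormedModule.tendsto_ind_smul (μ := μ)
    (fun n => (Finset.range n).measurableSet_biUnion fun k _ => hS n k) (fun x => ?_) _)
    (Eventually.of_forall fun n => Linfty.ind_biUnion_smul_mem _ _ (hS n) fun k =>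
      F.ind_smul_mem_span μ ω (hS n k) (f (p k)) (ha k) (K := n)
        (fun i x hx => mem_iInter.1 hx.2 i) fun x hx => hf (p k) x hx.1 _)
  have hx : x ∈ ⋃ y ∈ range p, W y := hcov ▸ mem_univ x
  simp only [mem_iUnion, mem_range, exists_prop, exists_exists_eq_and] at hx
  obtain ⟨k, hk⟩ := hx
  have h1 : ∀ i, ∀ᶠ n : ℕ in atTop, |a k i x| ≤ n := fun i =>
    (tendsto_natCast_atTop_atTop (R := ℝ)).eventually_ge_atTop _
  -- A point of `W (p k)` lies in the union as soon as `n > k` and `n` exceeds its finitely many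
  -- coefficients.
  filter_upwards [eventually_gt_atTop k, eventually_all.2 h1] with n hn hn'
  exact mem_iUnion₂.2 ⟨k, Finset.mem_range.2 hn, hk, mem_iInter.2 hn'⟩

end FinslerStructure

end

/-! ### Extension by continuity and conclusion. -/

/-- A densely defined module homomorphism that does not increase pointwise norms extends uniquely
to a continuous one. -/
theorem L2NormedModule.exists_extension {X : Type*} [MeasurableSpace X] {μ : Measure X}
    {T T' : Type*} [NormedAddCommGroup T] [NormedSpace ℝ T] [Module (Linfty μ) T]
    [L2NormedModule μ T] [IsScalarTower ℝ (Linfty μ) T]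
    [NormedAddCommGroup T'] [NormedSpace ℝ T'] [CompleteSpace T'] [Module (Linfty μ) T']
    [L2NormedModule μ T'] [IsScalarTower ℝ (Linfty μ) T']
    (hT : IsPointwiseSeminorm (pnorm : T → Lp ℝ 2 μ))
    (hT' : IsPointwiseSeminorm (pnorm : T' → Lp ℝ 2 μ))
    {V : Type*} [AddCommGroup V] [Module (Linfty μ) V] (A : V →ₗ[Linfty μ] T)
    (B : V →ₗ[Linfty μ] T') (hA : DenseRange A)
    (hAB : ∀ u, pnorm (μ := μ) (B u) ≤ pnorm (μ := μ) (A u)) :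
    ∃ P : T →L[Linfty μ] T', (∀ u, P (A u) = B u) ∧
      (∀ Q : T →L[Linfty μ] T', (∀ u, Q (A u) = B u) → Q = P) ∧
      ∀ v, pnorm (μ := μ) (P v) ≤ pnorm (μ := μ) v := by
  -- `V` becomes a real vector space through the constants, so that the extension theorem for real
  -- normed spaces applies; `L^∞(μ)`-linearity is recovered by density.
  let _ : Module ℝ V := Module.compHom V (algebraMap ℝ (Linfty μ))
  have : IsScalarTower ℝ (Linfty μ) V := IsScalarTower.of_algebraMap_smul fun _ _ => rfl
  have hbd : ∀ u, ‖B u‖ ≤ 1 * ‖A u‖ := fun u => by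
    rw [one_mul, ← norm_pnorm (μ := μ) (B u), ← norm_pnorm (μ := μ) (A u)]
    refine norm_le_norm_of_abs_le_abs ?_
    rw [abs_of_nonneg (pnorm_nonneg _), abs_of_nonneg (pnorm_nonneg _)]
    exact hAB u
  let P₀ : T →L[ℝ] T' := (B.restrictScalars ℝ).extendOfNorm (A.restrictScalars ℝ)
  have hP₀ : ∀ u, P₀ (A u) = B u := LinearMap.extendOfNorm_eq (f := B.restrictScalars ℝ)
    (e := A.restrictScalars ℝ) hA ⟨1, hbd⟩
  have hsmul : ∀ (a : Linfty μ) v, P₀ (a • v) = a • P₀ v := fun a v => by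
    refine hA.induction_on (p := fun v => P₀ (a • v) = a • P₀ v) v (isClosed_eq
      (P₀.continuous.comp (continuous_const_smul a))
      ((continuous_const_smul a).comp P₀.continuous)) fun u => ?_
    rw [← map_smul, hP₀, hP₀, map_smul]
  refine ⟨⟨⟨P₀.toLinearMap.toAddHom, hsmul⟩, P₀.continuous⟩, hP₀, fun Q hQ => ?_, fun v => ?_⟩
  · refine ContinuousLinearMap.ext fun v => hA.induction_on (p := fun v => Q v = P₀ v) v
      (isClosed_eq Q.continuous P₀.continuous) fun u => ?_
    rw [hQ, hP₀]
  · refine hA.induction_on (p := fun v => pnorm (μ := μ) (P₀ v) ≤ pnorm (μ := μ) v) v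
      (isClosed_le ((continuous_pnorm hT').comp P₀.continuous) (continuous_pnorm hT)) fun u => ?_
    rw [hP₀]
    exact hAB u

end

end FinslerModules

end

theorem mainTheorem7
    {E : Type*} [NormedAddCommGroup E] [NormedSpace ℝ E] [FiniteDimensional ℝ E]
    {M : Type*} [TopologicalSpace M] [T2Space M] [SecondCountableTopology M] [ConnectedSpace M]
    [ChartedSpace E M] [IsManifold 𝓘(ℝ, E) ((⊤ : ℕ∞) : WithTop ℕ∞) M]
    [MeasurableSpace M] [BorelSpace M]
    (F : FinslerStructure E M) (hF : F.IsReversible)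
    (μ : Measure M) [IsLocallyFiniteMeasure μ] :
    ∃ (hW : ∀ f : C1c E M, f.toL2 μ ∈ sobolev F.dist μ)
      (P : F.Gamma2 μ →L[Linfty μ] CotangentModule F.dist μ),
      (∀ f : C1c E M, P (f.concreteDiff F μ) =
        CotangentModule.differential F.dist μ ⟨f.toL2 μ, hW f⟩) ∧
      (∀ Q : F.Gamma2 μ →L[Linfty μ] CotangentModule F.dist μ,
        (∀ f : C1c E M, Q (f.concreteDiff F μ) =
          CotangentModule.differential F.dist μ ⟨f.toL2 μ, hW f⟩) → Q = P) ∧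
      ∀ ω : F.Gamma2 μ, ∀ᵐ x ∂μ,
        L2NormedModule.pnorm (μ := μ) (P ω) x ≤ L2NormedModule.pnorm (μ := μ) ω x := by
  -- Both modules receive a map from the free `L^∞(μ)`-module on `C¹_c(M)`. The operator is the
  -- extension of the correspondence between these two maps, which avoids choosing how to write an
  -- element of the span.
  have hdense : DenseRange (Finsupp.linearCombination (Linfty μ)
      fun f : C1c E M => f.concreteDiff F μ) := by
    have h := F.dense_span_concreteDiff μ
    rw [← Finsupp.range_linearCombination] at h
    exact h
  obtain ⟨P, hP, huniq, hle⟩ := L2NormedModule.exists_extension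
    FinslerStructure.Gamma2.isPointwiseSeminorm_pnorm CotangentModule.isPointwiseSeminorm_pnorm
    (Finsupp.linearCombination (Linfty μ) fun f : C1c E M => f.concreteDiff F μ)
    (Finsupp.linearCombination (Linfty μ) fun f : C1c E M => f.abstractDiff F μ) hdense fun u => by
      rw [Finsupp.linearCombination_apply, Finsupp.linearCombination_apply, Finsupp.sum,
        Finsupp.sum, ← Finset.sum_coe_sort, ← Finset.sum_coe_sort u.support]
      exact C1c.pnorm_sum_smul_abstractDiff_le F μ (fun f : u.support => (f : C1c E M))
        fun f => u f
  refine ⟨fun f => f.toL2_mem_sobolev F μ, P, fun f => ?_, fun Q hQ => huniq Q fun u => ?_,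
    fun ω => (Lp.coeFn_le _ _).2 (hle ω)⟩
  -- The prescribed value at `\underline df` is the case of the free generator `f`. Conversely,
  -- values on the generators determine those on all combinations, whence uniqueness.
  · have := hP (Finsupp.single f 1)
    rwa [Finsupp.linearCombination_single, Finsupp.linearCombination_single, one_smul,
      one_smul] at this
  · rw [Finsupp.linearCombination_apply, Finsupp.linearCombination_apply, Finsupp.sum,
      Finsupp.sum, map_sum]
    refine Finset.sum_congr rfl fun f _ => ?_
    rw [map_smul, hQ f]
    rfl
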